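/- Let $d,q\ge 1$ and let $(X,Y),(X_1,Y_1),(X_2,Y_2),\dots$ be i.i.d. $\mathbb{R}^d\times\mathbb{R}^q$-valued random variables with joint probability density $f(x,y)$ and $\mathbb{E}\|Y\|<\infty$. Let $h_n=cn^{-a}$ $(n\ge1)$ with $c>0$ and $0<a<1/d$, let $K:\mathbb{R}^d\to\mathbb{R}$ be measurable, and fix $x\in\mathbb{R}^d$ with $g(x):=\int_{\mathbb{R}^q}f(x,y)\,dy>0$. Put $$\tilde m_n(x)=\frac1n\sum_{i=1}^n\frac{Y_i}{h_i^d}K\Big(\frac{x-X_i}{h_i}\Big),\qquad \tilde g_n(x)=\frac1n\sum_{i=1}^n\frac{1}{h_i^d}K\Big(\frac{x-X_i}{h_i}\Big),$$ and $\tilde r_n(x)=\tilde m_n(x)/\tilde g_n(x)$ if $\tilde g_n(x)\ne0$, $\tilde r_n(x)=0$ otherwise. For $(u,v),(t_1,t_2)\in\mathbb{R}^q\times\mathbb{R}$ and $s\in\mathbb{R}^q$ define $$\tilde\Psi_{a,x}(u,v)=\int_{[0,1]\times\mathbb{R}^d\times\mathbb{R}^q}\tau^{-ad}\Big(e^{\tau^{ad}(\langle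 u,y\rangle+v)K(z)}-1\Big)f(x,y)\,d\tau\,dz\,dy,$$ $$\tilde I_{a,x}(t_1,t_2)=\sup_{(u,v)\in\mathbb{R}^q\times\mathbb{R}}\{\langle u,t_1\rangle+vt_2-\tilde\Psi_{a,x}(u,v)\},\qquad \tilde J_a(s)=\min\Big\{\inf_{t\ne0}\tilde I_{a,x}(st,t),\ \tilde I_{a,x}(\vec0,0)\Big\}.$$ Assume: (A1) $K$ is bounded and integrable, $\int_{\mathbb{R}^d}K(z)\,dz=1$ and $\lim_{\|z\|\to\infty}K(z)=0$; (A2) for every $u\in\mathbb{R}^q$ the function $t\mapsto\int_{\mathbb{R}^q}e^{\langle u,y\rangle}f(t,y)\,dy$ is (finite and) bounded on $\mathbb{R}^d$ and continuous at $x$; (A'1) for every $u\in\mathbb{R}^q$ the function $t\mapsto\int_{\mathbb{R}^q}e^{\alpha\langle u,y\rangle}f(t,y)\,dy$ is continuous at $x$ uniformly with respect to $\alpha\in[0,1]$; (C') $\inf_{s\in\mathbb{R}^q}\tilde I_{a,x}(s,0)=\tilde I_{a,x}(\vec0,0)$. Suppose moreover that $K\ge0$ and that $\{z\in\mathbb{R}^d: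 K(z)>0\}$ has infinite Lebesgue measure. Then $\tilde J_a$ is a good rate function on $\mathbb{R}^q$, i.e. it is lower semicontinuous with values in $[0,\infty]$ and compact level sets $\{\tilde J_a\le\alpha\}$, $\alpha<\infty$; and $(\tilde r_n(x))_{n\ge1}$ satisfies the large deviations principle with speed $(nh_n^d)$ and rate function $\tilde J_a$: $nh_n^d>0$ and $nh_n^d\to\infty$, for every open $U\subset\mathbb{R}^q$ $$\liminf_{n\to\infty}\frac{1}{nh_n^d}\log\mathbb{P}[\tilde r_n(x)\in U]\ge-\inf_{s\in U}\tilde J_a(s),$$ and for every closed $V\subset\mathbb{R}^q$ $$\limsup_{n\to\infty}\frac{1}{nh_n^d}\log\mathbb{P}[\tilde r_n(x)\in V]\le-\inf_{s\in V}\tilde J_a(s).$$ -/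

import Mathlib

open MeasureTheory ProbabilityTheory Filter Topology

noncomputable section

/-- The Euclidean space of dimension `d`. -/
abbrev Euc (d : ℕ) : Type := EuclideanSpace ℝ (Fin d)

/-- A good rate function: a lower semicontinuous function with values in `[0, ∞]`, all of whose
level sets at finite levels are compact. -/
structure IsGoodRateFunction {E : Type*} [TopologicalSpace E] (I : E → EReal) : Prop where
  nonneg : ∀ s, 0 ≤ I s
  lowerSemicontinuous : LowerSemicontinuous I
  isCompact_level : ∀ α : ℝ, IsCompact {s | I s ≤ (α : EReal)}

/-- `(Z n)`, `n ≥ 1`, satisfies the large deviations principle with speed `ν` and rate `I`.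
Here `ENNReal.log` is the logarithm `[0, ∞] → [-∞, ∞]`, with `log 0 = -∞`. -/
structure SatisfiesLDP {Ω E : Type*} [MeasurableSpace Ω] [TopologicalSpace E]
    (P : Measure Ω) (Z : ℕ → Ω → E) (ν : ℕ → ℝ) (I : E → EReal) : Prop where
  speed_pos : ∀ n, 1 ≤ n → 0 < ν n
  speed_tendsto : Tendsto ν atTop atTop
  lower : ∀ U : Set E, IsOpen U →
    -(⨅ s ∈ U, I s) ≤
      liminf (fun n => (((ν n)⁻¹ : ℝ) : EReal) * ENNReal.log (P {ω | Z n ω ∈ U})) atTop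
  upper : ∀ V : Set E, IsClosed V →
    limsup (fun n => (((ν n)⁻¹ : ℝ) : EReal) * ENNReal.log (P {ω | Z n ω ∈ V})) atTop ≤
      -(⨅ s ∈ V, I s)

/-- The pairs `(X i, Y i)` are independent and identically distributed with joint density `f`
on `ℝ^d × ℝ^q`, and `𝔼‖Y‖ < ∞`. The pair of index `0` is the generic copy `(X, Y)`. -/
structure IsIIDSampleWithDensity {Ω : Type*} [MeasurableSpace Ω] {d q : ℕ} (P : Measure Ω)
    (X : ℕ → Ω → Euc d) (Y : ℕ → Ω → Euc q) (f : Euc d → Euc q → ℝ) : Prop where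
  density_measurable : Measurable (fun p : Euc d × Euc q => f p.1 p.2)
  density_nonneg : ∀ t y, 0 ≤ f t y
  measurable_X : ∀ i, Measurable (X i)
  measurable_Y : ∀ i, Measurable (Y i)
  indep : iIndepFun (fun i ω => (X i ω, Y i ω)) P
  law : ∀ i, P.map (fun ω => (X i ω, Y i ω)) =
    (volume : Measure (Euc d × Euc q)).withDensity (fun p => ENNReal.ofReal (f p.1 p.2))
  integrable_Y : Integrable (Y 0) P

/-- The marginal density of `X`. -/
def marginalDensity {d q : ℕ} (f : Euc d → Euc q → ℝ) (t : Euc d) : ℝ :=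
  ∫ y, f t y

/-- The assumptions on the kernel: measurable, bounded, integrable with integral one, vanishing
at infinity. -/
structure KernelAssumption {d : ℕ} (K : Euc d → ℝ) : Prop where
  measurable : Measurable K
  bounded : ∃ C : ℝ, ∀ z, |K z| ≤ C
  integrable : Integrable K
  integral_eq_one : ∫ z, K z = 1
  tendsto_zero : Tendsto K (cocompact (Euc d)) (𝓝 0)

/-- The exponential moment `∫ exp ⟨u, y⟩ f(t, y) dy`. -/
def expMoment {d q : ℕ} (f : Euc d → Euc q → ℝ) (u : Euc q) (t : Euc d) : ℝ :=
  ∫ y, Real.exp (inner ℝ u y) * f t y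

/-- Every exponential moment is finite, bounded in `t` and continuous at `x`. -/
structure ExpMomentAssumption {d q : ℕ} (f : Euc d → Euc q → ℝ) (x : Euc d) : Prop where
  finite : ∀ (u : Euc q) (t : Euc d), Integrable (fun y => Real.exp (inner ℝ u y) * f t y)
  bounded : ∀ u : Euc q, ∃ C : ℝ, ∀ t, expMoment f u t ≤ C
  continuousAt : ∀ u : Euc q, ContinuousAt (expMoment f u) x

/-- For each `u`, continuity at `x` of `t ↦ ∫ exp (α ⟨u, y⟩) f(t, y) dy`,
uniformly with respect to `α ∈ [0, 1]`. -/
def UniformExpMomentAssumption {d q : ℕ} (f : Euc d → Euc q → ℝ) (x : Euc d) : Prop :=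
  ∀ u : Euc q, ∀ ε > 0, ∃ δ > 0, ∀ t, dist t x < δ → ∀ α ∈ Set.Icc (0 : ℝ) 1,
    |expMoment f (α • u) t - expMoment f (α • u) x| < ε

/-- The numerator `m̃_n(x)` for the bandwidth sequence `h`. -/
def semiRecNum {Ω : Type*} {d q : ℕ} (K : Euc d → ℝ) (h : ℕ → ℝ) (X : ℕ → Ω → Euc d)
    (Y : ℕ → Ω → Euc q) (x : Euc d) (n : ℕ) (ω : Ω) : Euc q :=
  (1 / (n : ℝ)) • ∑ i ∈ Finset.Icc 1 n,
    (1 / h i ^ d * K ((h i)⁻¹ • (x - X i ω))) • Y i ω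

/-- The denominator `g̃_n(x)` for the bandwidth sequence `h`. -/
def semiRecDen {Ω : Type*} {d : ℕ} (K : Euc d → ℝ) (h : ℕ → ℝ) (X : ℕ → Ω → Euc d)
    (x : Euc d) (n : ℕ) (ω : Ω) : ℝ :=
  (1 / (n : ℝ)) * ∑ i ∈ Finset.Icc 1 n, 1 / h i ^ d * K ((h i)⁻¹ • (x - X i ω))

open Classical in
/-- The semi-recursive kernel estimator `r̃_n(x)` of the regression. -/
def semiRecEstimator {Ω : Type*} {d q : ℕ} (K : Euc d → ℝ) (h : ℕ → ℝ) (X : ℕ → Ω → Euc d)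
    (Y : ℕ → Ω → Euc q) (x : Euc d) (n : ℕ) (ω : Ω) : Euc q :=
  if semiRecDen K h X x n ω ≠ 0 then
    (semiRecDen K h X x n ω)⁻¹ • semiRecNum K h X Y x n ω
  else 0

/-- The function `Ψ̃_{a,x}(u, v)`, an integral over `(s, z, y) ∈ [0,1] × ℝ^d × ℝ^q`. -/
def semiRecPsi {d q : ℕ} (a : ℝ) (K : Euc d → ℝ) (f : Euc d → Euc q → ℝ) (x : Euc d)
    (u : Euc q) (v : ℝ) : ℝ :=
  ∫ p in (Set.Icc (0 : ℝ) 1) ×ˢ (Set.univ : Set (Euc d × Euc q)),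
    p.1 ^ (-(a * d)) *
      (Real.exp (p.1 ^ (a * d) * (inner ℝ u p.2.2 + v) * K p.2.1) - 1) * f x p.2.2

/-- The Fenchel-Legendre transform `Ĩ_{a,x}(t₁, t₂)` of `Ψ̃_{a,x}`. -/
def semiRecI {d q : ℕ} (a : ℝ) (K : Euc d → ℝ) (f : Euc d → Euc q → ℝ) (x : Euc d)
    (t₁ : Euc q) (t₂ : ℝ) : EReal :=
  ⨆ w : Euc q × ℝ, ((inner ℝ w.1 t₁ + w.2 * t₂ - semiRecPsi a K f x w.1 w.2 : ℝ) : EReal)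

/-- The function `J̃*_a(s) = inf_{t ≠ 0} Ĩ_{a,x}(s t, t)`. -/
def semiRecJStar {d q : ℕ} (a : ℝ) (K : Euc d → ℝ) (f : Euc d → Euc q → ℝ) (x : Euc d)
    (s : Euc q) : EReal :=
  ⨅ (t : ℝ) (_ : t ≠ 0), semiRecI a K f x (t • s) t

/-- The function `J̃_a(s) = J̃*_a(s) ∧ Ĩ_{a,x}(0, 0)`. -/
def semiRecJ {d q : ℕ} (a : ℝ) (K : Euc d → ℝ) (f : Euc d → Euc q → ℝ) (x : Euc d)
    (s : Euc q) : EReal :=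
  semiRecJStar a K f x s ⊓ semiRecI a K f x 0 0

/-- The condition `inf_s Ĩ_{a,x}(s, 0) = Ĩ_{a,x}(0, 0)`. -/
def SemiRecCondition {d q : ℕ} (a : ℝ) (K : Euc d → ℝ) (f : Euc d → Euc q → ℝ)
    (x : Euc d) : Prop :=
  (⨅ s : Euc q, semiRecI a K f x s 0) = semiRecI a K f x 0 0

end

/-! The estimator is the ratio of the two coordinates of the pair formed by the numerator and the
denominator, so a large deviations principle for the pair is transported through `(m, g) ↦ m / g`.

For `θ = (u, v)`, the speed times the inner product of `θ` with the pair is a sum of independent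
terms with weights `(h n / h i) ^ d = (i / n) ^ (a d) ≤ 1`. The substitution `z = (x - X i) / h i`
makes each exponential moment `1 + h i ^ d * A`, with `A` an integral of `compMoment`. Hence the
scaled cumulant generating function is an average over `i / n`, and dominated convergence in `τ = i
/ n` gives Ψ̃ (`KernelSetting.hasLimitingCGF`). Since Ψ̃ is finite and differentiable everywhere
(`differentiable_pairPsi`), the Gärtner–Ellis theorem applies with the Legendre transform Ĩ as rate.

The ratio is discontinuous at zero denominator. There the sign of `K` and the infinite measure of
`{K > 0}` intervene: `Ψ̃(0, v)` is unbounded below over `v ≤ 0`, so `Ĩ(t₁, t₂) = ∞` whenever `t₂ ≤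
0` (`legendre_eq_top`). The singular hyperplane thus contributes nothing to either bound, `J̃`
reduces to the infimum over `t ≠ 0`, and the compact level sets of Ĩ lie where the ratio is
continuous (`isGoodRateFunction_ratio`). -/

noncomputable section

/-! ### The Gärtner–Ellis theorem in finite dimension. -/

section GartnerEllis

variable {H : Type*} [NormedAddCommGroup H] [InnerProductSpace ℝ H]

variable {Ω : Type*} [MeasurableSpace Ω] {P : Measure Ω}
  {Z : ℕ → Ω → H} {ν : ℕ → ℝ} {Λ : H → ℝ}

/-- The scaled cumulant generating functions of `Z n` at speed `ν n` are finite and converge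
to `Λ`. -/
structure HasLimitingCGF (P : Measure Ω) (Z : ℕ → Ω → H) (ν : ℕ → ℝ) (Λ : H → ℝ) : Prop where
  speed_tendsto : Tendsto ν atTop atTop
  integrable : ∀ θ n, Integrable (fun ω => Real.exp (ν n * inner ℝ θ (Z n ω))) P
  tendsto : ∀ θ, Tendsto
    (fun n => (ν n)⁻¹ * Real.log (∫ ω, Real.exp (ν n * inner ℝ θ (Z n ω)) ∂P)) atTop (𝓝 (Λ θ))

namespace HasLimitingCGF

lemma eventually_pos (h : HasLimitingCGF P Z ν Λ) : ∀ᶠ n in atTop, 0 < ν n :=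
  h.speed_tendsto.eventually_gt_atTop 0

variable [IsProbabilityMeasure P]

lemma eventually_le (h : HasLimitingCGF P Z ν Λ) (θ : H) {b : ℝ} (hb : Λ θ < b) :
    ∀ᶠ n in atTop, ∫ ω, Real.exp (ν n * inner ℝ θ (Z n ω)) ∂P ≤ Real.exp (ν n * b) := by
  filter_upwards [h.eventually_pos, (h.tendsto θ).eventually_lt_const hb] with n hn hlt
  rw [← Real.log_le_iff_le_exp (integral_exp_pos (h.integrable θ n))]
  rw [inv_mul_lt_iff₀ hn] at hlt
  exact hlt.le

lemma eventually_ge (h : HasLimitingCGF P Z ν Λ) (θ : H) {b : ℝ} (hb : b < Λ θ) :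
    ∀ᶠ n in atTop, Real.exp (ν n * b) ≤ ∫ ω, Real.exp (ν n * inner ℝ θ (Z n ω)) ∂P := by
  filter_upwards [h.eventually_pos, (h.tendsto θ).eventually_const_lt hb] with n hn hlt
  rw [← Real.le_log_iff_exp_le (integral_exp_pos (h.integrable θ n))]
  rw [lt_inv_mul_iff₀ hn] at hlt
  exact hlt.le

lemma apply_zero (h : HasLimitingCGF P Z ν Λ) : Λ 0 = 0 := by
  have := h.tendsto 0
  simp only [inner_zero_left, mul_zero, Real.exp_zero, integral_const, probReal_univ, smul_eq_mul,
    mul_one, Real.log_one] at this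
  exact (tendsto_nhds_unique this tendsto_const_nhds)

/-- Chernoff's bound; the strict inequality leaves room for the convergence of the cumulant
generating functions. -/
lemma halfspace_le (h : HasLimitingCGF P Z ν Λ) (θ : H) {α b : ℝ} (hb : α < b - Λ θ) :
    ∀ᶠ n in atTop, P.real {ω | b ≤ inner ℝ θ (Z n ω)} ≤ Real.exp (-(ν n * α)) := by
  filter_upwards [h.eventually_pos, h.eventually_le θ (b := b - α) (by linarith)] with n hn hle
  refine (measure_ge_le_exp_mul_mgf b hn.le (h.integrable θ n)).trans ?_
  calc Real.exp (-ν n * b) * mgf (fun ω => inner ℝ θ (Z n ω)) P (ν n)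
      ≤ Real.exp (-ν n * b) * Real.exp (ν n * (b - α)) := by gcongr; exact hle
    _ = Real.exp (-(ν n * α)) := by rw [← Real.exp_add]; ring_nf

end HasLimitingCGF

variable [FiniteDimensional ℝ H]

/-- In finite dimension, the norm is controlled by the inner products with finitely many vectors. -/
lemma exists_finset_norm_le_inner (H : Type*) [NormedAddCommGroup H] [InnerProductSpace ℝ H]
    [FiniteDimensional ℝ H] :
    ∃ (S : Finset H) (c : ℝ), 0 < c ∧ ∀ z : H, ∃ e ∈ S, c * ‖z‖ ≤ inner ℝ e z := by
  classical
  let b := stdOrthonormalBasis ℝ H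
  let N : ℝ := Module.finrank ℝ H
  have hN : 0 ≤ N := Nat.cast_nonneg _
  -- If all coordinates were below `‖z‖ / (N + 1)` in absolute value, the triangle inequality would
  -- give `‖z‖ ≤ N / (N + 1) * ‖z‖`. The vector `0` takes care of `z = 0`.
  refine ⟨insert 0 (Finset.univ.image b ∪ Finset.univ.image (fun i => - b i)), 1 / (N + 1),
    by positivity, fun z => ?_⟩
  by_contra! hcon
  have h0 : 0 < 1 / (N + 1) * ‖z‖ := by simpa using hcon 0 (by simp)
  have hi : ∀ i, |inner ℝ (b i) z| ≤ 1 / (N + 1) * ‖z‖ := by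
    intro i
    have h1 := hcon (b i) (by simp)
    have h2 := hcon (-b i) (by simp)
    rw [inner_neg_left] at h2
    rw [abs_le]
    constructor <;> linarith
  have hz : ‖z‖ ≤ ∑ i, |inner ℝ (b i) z| := by
    calc ‖z‖ = ‖∑ i, inner ℝ (b i) z • b i‖ := by rw [b.sum_repr']
      _ ≤ ∑ i, ‖inner ℝ (b i) z • b i‖ := norm_sum_le _ _
      _ = ∑ i, |inner ℝ (b i) z| := by simp [norm_smul]
  have h2 : ∑ i, |inner ℝ (b i) z| ≤ N * (1 / (N + 1) * ‖z‖) := by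
    refine (Finset.sum_le_sum fun i _ => hi i).trans ?_
    simp [N]
  have h3 : ‖z‖ = (N + 1) * (1 / (N + 1) * ‖z‖) := by field_simp
  linarith

/-- A point with finite Legendre transform is approximated by gradients at which the Legendre
transform is not larger. -/
theorem exists_gradient_near {Λ : H → ℝ} (hΛ : Differentiable ℝ Λ) (h0 : Λ 0 = 0)
    {z : H} {b : ℝ} (hb : ∀ θ, inner ℝ θ z - Λ θ ≤ b) {r : ℝ} (hr : 0 < r) :
    ∃ θ g, HasGradientAt Λ g θ ∧ dist g z < r ∧ inner ℝ θ g - Λ θ ≤ b := by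
  have hb0 : 0 ≤ b := by simpa [h0] using hb 0
  -- The maximiser below satisfies `δ / 2 * ‖θ‖ ^ 2 ≤ b`, hence `(δ * ‖θ‖) ^ 2 ≤ 2 * δ * b`, and `δ
  -- * ‖θ‖` is the distance to control.
  obtain ⟨δ, hδ, hδr⟩ : ∃ δ > 0, 2 * δ * b < r ^ 2 := by
    refine ⟨r ^ 2 / (2 * (2 * (b + 1))), by positivity, ?_⟩
    have : 2 * (r ^ 2 / (2 * (2 * (b + 1)))) * b = r ^ 2 * (b / (2 * (b + 1))) := by
      field_simp
    rw [this]
    have h2 : b / (2 * (b + 1)) < 1 := by rw [div_lt_one (by positivity)]; linarith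
    nlinarith [sq_pos_of_pos hr]
  -- The quadratic penalty makes the supremum attained; the critical point equation is then `∇Λ θ =
  -- z - δ θ`.
  let φ : H → ℝ := fun θ => inner ℝ θ z - Λ θ - δ / 2 * ‖θ‖ ^ 2
  have hcont : Continuous φ := by
    have := hΛ.continuous
    fun_prop
  have hlim : Tendsto φ (cocompact H) atBot := by
    have h1 : Tendsto (fun θ : H => b - δ / 2 * ‖θ‖ ^ 2) (cocompact H) atBot := by
      apply tendsto_atBot_add_const_left
      apply Filter.tendsto_neg_atTop_atBot.comp
      exact ((tendsto_pow_atTop two_ne_zero).comp tendsto_norm_cocompact_atTop).const_mul_atTop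
        (by positivity)
    refine tendsto_atBot_mono (fun θ => ?_) h1
    have := hb θ
    simp only [φ]
    linarith
  obtain ⟨θ, hθ⟩ := hcont.exists_forall_ge hlim
  have hgrad : HasGradientAt Λ (gradient Λ θ) θ := (hΛ θ).hasGradientAt
  have hfd : HasFDerivAt φ (innerSL ℝ z - InnerProductSpace.toDual ℝ H (gradient Λ θ) -
      (δ / 2) • (2 • innerSL ℝ θ)) θ := by
    have h1 : HasFDerivAt (fun θ : H => inner ℝ θ z) (innerSL ℝ z) θ := by
      have := (innerSL ℝ z).hasFDerivAt (x := θ)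
      refine this.congr_of_eventuallyEq (Eventually.of_forall fun w => ?_)
      simp [real_inner_comm]
    exact (h1.sub hgrad.hasFDerivAt).sub ((hasStrictFDerivAt_norm_sq θ).hasFDerivAt.const_mul _)
  have hz0 : innerSL ℝ z - InnerProductSpace.toDual ℝ H (gradient Λ θ) -
      (δ / 2) • (2 • innerSL ℝ θ) = 0 :=
    (IsLocalMax.hasFDerivAt_eq_zero (Eventually.of_forall hθ) hfd)
  have hg : gradient Λ θ = z - δ • θ := by
    refine ext_inner_right ℝ fun w => ?_
    have := congrArg (fun L : H →L[ℝ] ℝ => L w) hz0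
    simp only [sub_apply, smul_apply,
      innerSL_apply_apply, InnerProductSpace.toDual_apply_apply, zero_apply,
      smul_eq_mul, nsmul_eq_mul, Nat.cast_ofNat] at this
    rw [inner_sub_left, real_inner_smul_left]
    linarith
  have hmax : 0 ≤ φ θ := by
    have := hθ 0
    simpa [φ, h0] using this
  have hbθ := hb θ
  simp only [φ] at hmax
  refine ⟨θ, gradient Λ θ, hgrad, ?_, ?_⟩
  · rw [hg, dist_eq_norm]
    have h1 : ‖z - δ • θ - z‖ = δ * ‖θ‖ := by
      rw [sub_sub_cancel_left, norm_neg, norm_smul, Real.norm_of_nonneg hδ.le]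
    rw [h1]
    have h2 : (δ * ‖θ‖) ^ 2 < r ^ 2 := by nlinarith
    exact lt_of_pow_lt_pow_left₀ 2 hr.le h2
  · rw [hg, inner_sub_right, real_inner_smul_right, real_inner_self_eq_norm_sq]
    nlinarith [sq_nonneg ‖θ‖]

namespace HasLimitingCGF

variable [IsProbabilityMeasure P]

/-- Upper bound of the Gärtner–Ellis theorem. -/
theorem upper_bound (h : HasLimitingCGF P Z ν Λ) {F : Set H} (hF : IsClosed F) {α : ℝ}
    (hα : ∀ z ∈ F, ∃ θ, α < inner ℝ θ z - Λ θ) :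
    ∃ C : ℝ, ∀ᶠ n in atTop, P.real {ω | Z n ω ∈ F} ≤ C * Real.exp (-(ν n * α)) := by
  classical
  -- This property passes to subsets and finite unions, the constant `C` absorbing the number of
  -- pieces, so it can be proved on half-spaces and extended by compactness.
  let p : Set H → Prop := fun A =>
    ∃ C : ℝ, ∀ᶠ n in atTop, P.real {ω | Z n ω ∈ A} ≤ C * Real.exp (-(ν n * α))
  have p_empty : p ∅ := ⟨0, by simp⟩
  have p_mono : ∀ ⦃s t : Set H⦄, s ⊆ t → p t → p s := by
    rintro s t hst ⟨C, hC⟩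
    exact ⟨C, hC.mono fun n hn => (measureReal_mono (show {ω | Z n ω ∈ s} ⊆ {ω | Z n ω ∈ t} from
      fun ω hω => hst hω)).trans hn⟩
  have p_union : ∀ ⦃s t : Set H⦄, p s → p t → p (s ∪ t) := by
    rintro s t ⟨C, hC⟩ ⟨D, hD⟩
    refine ⟨C + D, ?_⟩
    filter_upwards [hC, hD] with n h1 h2
    refine (measureReal_union_le {ω | Z n ω ∈ s} {ω | Z n ω ∈ t}).trans ?_
    linarith
  have p_half : ∀ (θ : H) (b : ℝ), α < b - Λ θ → p {z | b ≤ inner ℝ θ z} := by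
    intro θ b hb
    exact ⟨1, by simpa using h.halfspace_le θ hb⟩
  obtain ⟨S, c, hc, hS⟩ := exists_finset_norm_le_inner H
  obtain ⟨M, hM⟩ : ∃ M : ℝ, ∀ e ∈ S, Λ e ≤ M := by
    obtain ⟨M, hM⟩ := (S.image Λ).bddAbove
    exact ⟨M, fun e he => hM (by simpa using ⟨e, he, rfl⟩)⟩
  -- Chosen so that `c * R - Λ e ≥ α + 1` for all `e ∈ S`: finitely many Chernoff bounds then cover
  -- the exterior of the ball, which is exponential tightness.
  let R : ℝ := (α + M + 1) / c
  have hR : c * R = α + M + 1 := by simp only [R]; field_simp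
  have p_far : p {z | R ≤ ‖z‖} := by
    have key : ∀ T : Finset H, (∀ e ∈ T, Λ e ≤ M) → p (⋃ e ∈ T, {z | c * R ≤ inner ℝ e z}) := by
      intro T
      induction T using Finset.induction_on with
      | empty => intro _; simpa using p_empty
      | insert e T he ih =>
        intro hT
        rw [Finset.set_biUnion_insert]
        refine p_union (p_half e _ ?_) (ih fun e he => hT e (by simp [he]))
        have := hT e (by simp)
        linarith
    refine p_mono ?_ (key S hM)
    intro z hz
    obtain ⟨e, he, hle⟩ := hS z
    simp only [Set.mem_iUnion, Set.mem_ofPred_eq]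
    exact ⟨e, he, le_trans (by gcongr; exact hz) hle⟩
  have p_near : p (F ∩ Metric.closedBall 0 R) := by
    refine ((isCompact_closedBall (0 : H) R).inter_left hF).induction_on p_empty p_mono p_union ?_
    rintro z ⟨hz, -⟩
    obtain ⟨θ, hθ⟩ := hα z hz
    obtain ⟨b, hb1, hb2⟩ := exists_between (show α + Λ θ < inner ℝ θ z by linarith)
    refine ⟨{z | b ≤ inner ℝ θ z}, mem_nhdsWithin_of_mem_nhds ?_, p_half θ b (by linarith)⟩
    have hcont : Continuous fun z : H => inner ℝ θ z := by fun_prop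
    exact (hcont.tendsto z).eventually (Ici_mem_nhds hb2)
  refine p_mono ?_ (p_union p_near p_far)
  intro z hz
  by_cases hzR : ‖z‖ ≤ R
  · exact Or.inl ⟨hz, by simpa using hzR⟩
  · exact Or.inr (not_le.1 hzR).le

/-- Local lower bound at the gradients of the limiting cumulant generating function. -/
theorem lower_bound_gradient [MeasurableSpace H] [BorelSpace H] (h : HasLimitingCGF P Z ν Λ)
    (hZ : ∀ n, Measurable (Z n)) {θ g : H} (hg : HasGradientAt Λ g θ) {r η : ℝ} (hr : 0 < r)
    (hη : 0 < η) :
    ∀ᶠ n in atTop, Real.exp (-(ν n * (inner ℝ θ g - Λ θ + η))) ≤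
      P.real {ω | Z n ω ∈ Metric.ball g r} := by
  classical
  obtain ⟨S, c, hc, hS⟩ := exists_finset_norm_le_inner H
  -- On a ball of radius `r'` the functional `inner ℝ θ` varies by at most `η / 4`.
  obtain ⟨r', hr', hr'r, hr'η⟩ : ∃ r' > 0, r' ≤ r ∧ ‖θ‖ * r' ≤ η / 4 := by
    refine ⟨min r (η / (4 * (‖θ‖ + 1))), by positivity, min_le_left _ _, ?_⟩
    calc ‖θ‖ * min r (η / (4 * (‖θ‖ + 1))) ≤ (‖θ‖ + 1) * (η / (4 * (‖θ‖ + 1))) := by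
          gcongr
          · linarith
          · exact min_le_right _ _
      _ = η / 4 := by field_simp
  have hcr : 0 < c * r' := by positivity
  -- The derivative of `Λ` at `θ` along `e` is `inner ℝ e g`, so a small step `t` increases `Λ` by
  -- less than `t * (inner ℝ e g + c * r' / 2)`. Under the law tilted by `θ`, the half-space at
  -- level `inner ℝ e g + c * r'` is therefore exponentially unlikely.
  have hdir : ∀ e : H, ∃ t > 0, Λ (θ + t • e) < Λ θ + t * (inner ℝ e g + c * r' / 2) := by
    intro e
    have h1 : HasDerivAt (fun t : ℝ => Λ (θ + t • e)) (inner ℝ e g) 0 := by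
      have h2 : HasDerivAt (fun t : ℝ => θ + t • e) e 0 := by
        simpa using ((hasDerivAt_id (0 : ℝ)).smul_const e).const_add θ
      have h3 : HasFDerivAt Λ ((InnerProductSpace.toDual ℝ H) g) (θ + (0 : ℝ) • e) := by
        simpa using hg.hasFDerivAt
      have := h3.comp_hasDerivAt (0 : ℝ) h2
      rw [InnerProductSpace.toDual_apply_apply, real_inner_comm] at this
      exact this
    have h4 := h1.tendsto_slope_zero_right
    have h5 := h4.eventually_lt_const (show inner ℝ e g < inner ℝ e g + c * r' / 2 by linarith)
    obtain ⟨t, ht, ht0⟩ := (h5.and self_mem_nhdsWithin).exists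
    refine ⟨t, ht0, ?_⟩
    simp only [zero_add, zero_smul, add_zero, smul_eq_mul] at ht
    rw [inv_mul_lt_iff₀ ht0] at ht
    linarith
  choose t ht0 ht using hdir
  -- With each half-space carrying at most `1 / m` of the tilted mass, all of them together carry at
  -- most half.
  let m : ℝ := 2 * (S.card + 1)
  have hm : 0 < m := by positivity
  have hterm : ∀ e ∈ S, ∀ᶠ n in atTop,
      Real.exp (-(ν n * (t e * (inner ℝ e g + c * r')))) *
        ∫ ω, Real.exp (ν n * inner ℝ (θ + t e • e) (Z n ω)) ∂P ≤
      m⁻¹ * ∫ ω, Real.exp (ν n * inner ℝ θ (Z n ω)) ∂P := by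
    intro e _
    have hs : 0 < t e * (c * r') := mul_pos (ht0 e) hcr
    have hexp : Tendsto (fun n => Real.exp (-(ν n * (t e * (c * r') / 4)))) atTop (𝓝 0) :=
      Real.tendsto_exp_neg_atTop_nhds_zero.comp (h.speed_tendsto.atTop_mul_const (by positivity))
    -- The margin is `t e * (c * r') / 2`: two eighths pay for the two limits, and the remaining
    -- quarter decays.
    filter_upwards [h.eventually_le (θ + t e • e) (b := Λ (θ + t e • e) + t e * (c * r') / 8)
        (by linarith), h.eventually_ge θ (b := Λ θ - t e * (c * r') / 8) (by linarith),
        hexp.eventually_le_const (inv_pos.2 hm), h.eventually_pos] with n h1 h2 h3 h4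
    calc Real.exp (-(ν n * (t e * (inner ℝ e g + c * r')))) *
          ∫ ω, Real.exp (ν n * inner ℝ (θ + t e • e) (Z n ω)) ∂P
        ≤ Real.exp (-(ν n * (t e * (inner ℝ e g + c * r')))) *
          Real.exp (ν n * (Λ (θ + t e • e) + t e * (c * r') / 8)) := by gcongr
      _ ≤ Real.exp (-(ν n * (t e * (c * r') / 4))) *
          Real.exp (ν n * (Λ θ - t e * (c * r') / 8)) := by
          rw [← Real.exp_add, ← Real.exp_add]
          apply Real.exp_le_exp.2
          have := mul_le_mul_of_nonneg_left (ht e).le h4.le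
          linarith
      _ ≤ _ := by gcongr
  have hexp : Tendsto (fun n => Real.exp (-(ν n * (η / 4)))) atTop (𝓝 0) :=
    Real.tendsto_exp_neg_atTop_nhds_zero.comp (h.speed_tendsto.atTop_mul_const (by positivity))
  filter_upwards [(Filter.eventually_all_finset S).2 hterm, h.eventually_pos,
    h.eventually_ge θ (b := Λ θ - η / 4) (by linarith),
    hexp.eventually_le_const (show (0 : ℝ) < 2⁻¹ by norm_num)] with n h1 hn h3 h4
  set I := ∫ ω, Real.exp (ν n * inner ℝ θ (Z n ω)) ∂P with hI
  set B : Set Ω := {ω | Z n ω ∈ Metric.ball g r'} with hB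
  have hBm : MeasurableSet B := hZ n Metric.isOpen_ball.measurableSet
  -- In the ball the exponential is nearly its value at `g`. Outside, some `e ∈ S` has `inner ℝ e (Z
  -- n ω - g) ≥ c * r'`, and the corresponding exponential Markov factor is at least one.
  have hpt : ∀ ω, Real.exp (ν n * inner ℝ θ (Z n ω)) ≤
      B.indicator (fun _ => Real.exp (ν n * (inner ℝ θ g + η / 4))) ω +
      ∑ e ∈ S, Real.exp (-(ν n * (t e * (inner ℝ e g + c * r')))) *
        Real.exp (ν n * inner ℝ (θ + t e • e) (Z n ω)) := by
    intro ω
    by_cases hω : ω ∈ B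
    · rw [Set.indicator_of_mem hω]
      have hnn : 0 ≤ ∑ e ∈ S, Real.exp (-(ν n * (t e * (inner ℝ e g + c * r')))) *
        Real.exp (ν n * inner ℝ (θ + t e • e) (Z n ω)) :=
        Finset.sum_nonneg fun e _ => by positivity
      have h5 : inner ℝ θ (Z n ω) ≤ inner ℝ θ g + η / 4 := by
        have h6 : inner ℝ θ (Z n ω - g) ≤ ‖θ‖ * ‖Z n ω - g‖ := real_inner_le_norm _ _
        have h7 : ‖Z n ω - g‖ ≤ r' := by
          have : Z n ω ∈ Metric.ball g r' := hω
          rw [mem_ball_iff_norm] at this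
          exact this.le
        rw [inner_sub_right] at h6
        nlinarith [norm_nonneg θ]
      have : Real.exp (ν n * inner ℝ θ (Z n ω)) ≤ Real.exp (ν n * (inner ℝ θ g + η / 4)) := by
        gcongr
      linarith
    · rw [Set.indicator_of_notMem hω, zero_add]
      obtain ⟨e, he, hle⟩ := hS (Z n ω - g)
      have h7 : r' ≤ ‖Z n ω - g‖ := by
        have : Z n ω ∉ Metric.ball g r' := hω
        rw [mem_ball_iff_norm] at this
        exact not_lt.1 this
      have h8 : inner ℝ e g + c * r' ≤ inner ℝ e (Z n ω) := by
        rw [inner_sub_right] at hle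
        nlinarith
      refine le_trans ?_ (Finset.single_le_sum (f := fun e =>
        Real.exp (-(ν n * (t e * (inner ℝ e g + c * r')))) *
        Real.exp (ν n * inner ℝ (θ + t e • e) (Z n ω))) (fun e _ => by positivity) he)
      rw [← Real.exp_add]
      apply Real.exp_le_exp.2
      rw [inner_add_left, real_inner_smul_left]
      have := mul_le_mul_of_nonneg_left h8 (mul_nonneg hn.le (ht0 e).le)
      linarith
  have hint : I ≤ Real.exp (ν n * (inner ℝ θ g + η / 4)) * P.real B +
      ∑ e ∈ S, Real.exp (-(ν n * (t e * (inner ℝ e g + c * r')))) *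
        ∫ ω, Real.exp (ν n * inner ℝ (θ + t e • e) (Z n ω)) ∂P := by
    have i1 : Integrable (B.indicator fun _ => Real.exp (ν n * (inner ℝ θ g + η / 4))) P :=
      (integrable_const _).indicator hBm
    have i2 : ∀ e ∈ S, Integrable (fun ω => Real.exp (-(ν n * (t e * (inner ℝ e g + c * r')))) *
        Real.exp (ν n * inner ℝ (θ + t e • e) (Z n ω))) P :=
      fun e _ => (h.integrable _ n).const_mul _
    refine (integral_mono (h.integrable θ n) (i1.add (integrable_finsetSum S i2)) hpt).trans
      (le_of_eq ?_)
    simp only [Pi.add_apply]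
    rw [integral_add i1 (integrable_finsetSum S i2), integral_finsetSum S i2,
      integral_indicator_const _ hBm, smul_eq_mul, mul_comm]
    simp_rw [integral_const_mul]
  have hI0 : 0 < I := integral_exp_pos (h.integrable θ n)
  have hsum : ∑ e ∈ S, Real.exp (-(ν n * (t e * (inner ℝ e g + c * r')))) *
        ∫ ω, Real.exp (ν n * inner ℝ (θ + t e • e) (Z n ω)) ∂P ≤ 2⁻¹ * I := by
    refine (Finset.sum_le_sum h1).trans ?_
    rw [Finset.sum_const, nsmul_eq_mul, ← mul_assoc]
    gcongr
    rw [← div_eq_mul_inv, div_le_iff₀ hm]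
    simp only [m]
    linarith
  have hlow : 2⁻¹ * I ≤ Real.exp (ν n * (inner ℝ θ g + η / 4)) * P.real B := by linarith
  have hfin : Real.exp (-(ν n * (inner ℝ θ g - Λ θ + η))) ≤ P.real B := by
    rw [← mul_le_mul_iff_right₀ (Real.exp_pos (ν n * (inner ℝ θ g + η / 4)))]
    refine le_trans ?_ hlow
    calc Real.exp (ν n * (inner ℝ θ g + η / 4)) * Real.exp (-(ν n * (inner ℝ θ g - Λ θ + η)))
        ≤ Real.exp (-(ν n * (η / 4))) * Real.exp (ν n * (Λ θ - η / 4)) := by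
          rw [← Real.exp_add, ← Real.exp_add]
          apply Real.exp_le_exp.2
          nlinarith
      _ ≤ 2⁻¹ * I := by gcongr
  exact hfin.trans (measureReal_mono fun ω hω => Metric.ball_subset_ball hr'r hω)

/-- Lower bound of the Gärtner–Ellis theorem. -/
theorem lower_bound [MeasurableSpace H] [BorelSpace H] (h : HasLimitingCGF P Z ν Λ)
    (hZ : ∀ n, Measurable (Z n)) (hΛ : Differentiable ℝ Λ) {G : Set H} (hG : IsOpen G)
    {z : H} (hz : z ∈ G) {b b' : ℝ} (hb : ∀ θ, inner ℝ θ z - Λ θ ≤ b) (hbb' : b < b') :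
    ∀ᶠ n in atTop, Real.exp (-(ν n * b')) ≤ P.real {ω | Z n ω ∈ G} := by
  obtain ⟨r, hr, hrG⟩ := Metric.isOpen_iff.1 hG z hz
  obtain ⟨θ, g, hg, hgz, hle⟩ :=
    exists_gradient_near hΛ h.apply_zero hb (half_pos hr)
  filter_upwards [h.lower_bound_gradient hZ hg (half_pos hr) (sub_pos.2 hbb'),
    h.eventually_pos] with n h1 hn
  refine le_trans ?_ (h1.trans (measureReal_mono fun ω hω => hrG ?_))
  · apply Real.exp_le_exp.2
    nlinarith
  · have h2 : dist (Z n ω) g < r / 2 := hω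
    have := dist_triangle (Z n ω) g z
    simp only [Metric.mem_ball]
    linarith

end HasLimitingCGF

end GartnerEllis

/-! ### From exponential estimates to logarithmic limits, and the Legendre transform. -/

section Rates

lemma limsup_inv_mul_log_le {Ω : Type*} [MeasurableSpace Ω] {P : Measure Ω}
    [IsFiniteMeasure P] {A : ℕ → Set Ω} {ν : ℕ → ℝ} (hν : Tendsto ν atTop atTop) {L : EReal}
    (h : ∀ α : ℝ, (α : EReal) < L → ∃ C : ℝ, ∀ᶠ n in atTop,
      P.real (A n) ≤ C * Real.exp (-(ν n * α))) :
    limsup (fun n => (((ν n)⁻¹ : ℝ) : EReal) * ENNReal.log (P (A n))) atTop ≤ -L := by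
  by_contra! hlt
  -- The real numbers `r` and `α` leave a gap `α + r > 0`, whose exponential eventually exceeds `C`.
  obtain ⟨r, hr1, hr2⟩ := EReal.lt_iff_exists_real_btwn.1 hlt
  have h1 : ((-r : ℝ) : EReal) < L := by
    rw [EReal.coe_neg]
    exact EReal.neg_lt_comm.1 hr1
  obtain ⟨α, hα1, hα2⟩ := EReal.lt_iff_exists_real_btwn.1 h1
  have hα1' : 0 < α + r := by
    have := EReal.coe_lt_coe_iff.1 hα1
    linarith
  obtain ⟨C, hC⟩ := h α hα2
  refine absurd hr2 (not_lt.2 (limsup_le_of_le (by isBoundedDefault) ?_))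
  have hexp : Tendsto (fun n => Real.exp (ν n * (α + r))) atTop atTop :=
    Real.tendsto_exp_atTop.comp (hν.atTop_mul_const hα1')
  filter_upwards [hC, hexp.eventually_ge_atTop C, hν.eventually_gt_atTop 0] with n h2 h3 h4
  have h5 : P.real (A n) ≤ Real.exp (ν n * r) := by
    refine h2.trans ?_
    calc C * Real.exp (-(ν n * α)) ≤ Real.exp (ν n * (α + r)) * Real.exp (-(ν n * α)) := by gcongr
      _ = Real.exp (ν n * r) := by rw [← Real.exp_add]; ring_nf
  have h6 : ENNReal.log (P (A n)) ≤ ((ν n * r : ℝ) : EReal) := by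
    rw [← ofReal_measureReal (μ := P) (s := A n)]
    refine (ENNReal.log_monotone (ENNReal.ofReal_le_ofReal h5)).trans ?_
    rw [ENNReal.log_ofReal_of_pos (Real.exp_pos _), Real.log_exp]
  calc (((ν n)⁻¹ : ℝ) : EReal) * ENNReal.log (P (A n))
      ≤ (((ν n)⁻¹ : ℝ) : EReal) * ((ν n * r : ℝ) : EReal) :=
        mul_le_mul_of_nonneg_left h6 (EReal.coe_nonneg.2 (inv_nonneg.2 h4.le))
    _ = (r : EReal) := by rw [← EReal.coe_mul, inv_mul_cancel_left₀ h4.ne']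

lemma le_liminf_inv_mul_log {Ω : Type*} [MeasurableSpace Ω] {P : Measure Ω}
    [IsFiniteMeasure P] {A : ℕ → Set Ω} {ν : ℕ → ℝ} (hν : Tendsto ν atTop atTop) {L : EReal}
    (h : ∀ b : ℝ, L < (b : EReal) → ∀ᶠ n in atTop, Real.exp (-(ν n * b)) ≤ P.real (A n)) :
    -L ≤ liminf (fun n => (((ν n)⁻¹ : ℝ) : EReal) * ENNReal.log (P (A n))) atTop := by
  by_contra! hlt
  obtain ⟨r, hr1, hr2⟩ := EReal.lt_iff_exists_real_btwn.1 hlt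
  have h1 : L < ((-r : ℝ) : EReal) := by
    rw [EReal.coe_neg]
    exact EReal.lt_neg_comm.1 hr2
  refine absurd hr1 (not_lt.2 (le_liminf_of_le (by isBoundedDefault) ?_))
  filter_upwards [h _ h1, hν.eventually_gt_atTop 0] with n h2 h4
  have h6 : ((ν n * r : ℝ) : EReal) ≤ ENNReal.log (P (A n)) := by
    rw [← ofReal_measureReal (μ := P) (s := A n)]
    refine le_trans ?_ (ENNReal.log_monotone (ENNReal.ofReal_le_ofReal h2))
    rw [ENNReal.log_ofReal_of_pos (Real.exp_pos _), Real.log_exp, mul_neg, neg_neg]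
  calc (r : EReal) = (((ν n)⁻¹ : ℝ) : EReal) * ((ν n * r : ℝ) : EReal) := by
        rw [← EReal.coe_mul, inv_mul_cancel_left₀ h4.ne']
    _ ≤ (((ν n)⁻¹ : ℝ) : EReal) * ENNReal.log (P (A n)) :=
        mul_le_mul_of_nonneg_left h6 (EReal.coe_nonneg.2 (inv_nonneg.2 h4.le))

variable {H : Type*} [NormedAddCommGroup H] [InnerProductSpace ℝ H]

/-- The Fenchel–Legendre transform, with values in the extended reals. -/
def legendre (Λ : H → ℝ) (z : H) : EReal :=
  ⨆ θ : H, ((inner ℝ θ z - Λ θ : ℝ) : EReal)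

lemma legendre_nonneg {Λ : H → ℝ} (h0 : Λ 0 = 0) (z : H) : 0 ≤ legendre Λ z := by
  refine le_iSup_of_le 0 ?_
  simp [h0]

lemma legendre_le_coe {Λ : H → ℝ} {z : H} {b : ℝ} :
    legendre Λ z ≤ b ↔ ∀ θ, inner ℝ θ z - Λ θ ≤ b := by
  simp [legendre, iSup_le_iff, EReal.coe_le_coe_iff, -EReal.coe_sub]

lemma coe_lt_legendre {Λ : H → ℝ} {z : H} {α : ℝ} :
    (α : EReal) < legendre Λ z ↔ ∃ θ, α < inner ℝ θ z - Λ θ := by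
  simp [legendre, lt_iSup_iff, EReal.coe_lt_coe_iff, -EReal.coe_sub]

lemma lowerSemicontinuous_legendre (Λ : H → ℝ) : LowerSemicontinuous (legendre Λ) := by
  refine lowerSemicontinuous_iSup fun θ => Continuous.lowerSemicontinuous ?_
  exact continuous_coe_real_ereal.comp (by fun_prop)

/-- Testing with the finitely many `e ∈ S`, where `Λ` is finite, gives `c * ‖z‖ ≤ inner ℝ e z ≤ α +
M` on the level set. -/
lemma isCompact_legendre_le [FiniteDimensional ℝ H] (Λ : H → ℝ) (α : ℝ) :
    IsCompact {z | legendre Λ z ≤ α} := by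
  obtain ⟨S, c, hc, hS⟩ := exists_finset_norm_le_inner H
  obtain ⟨M, hM⟩ : ∃ M : ℝ, ∀ e ∈ S, Λ e ≤ M := by
    classical
    obtain ⟨M, hM⟩ := (S.image Λ).bddAbove
    exact ⟨M, fun e he => hM (by simpa using ⟨e, he, rfl⟩)⟩
  refine (isCompact_closedBall (0 : H) ((α + M) / c)).of_isClosed_subset
    ((lowerSemicontinuous_legendre Λ).isClosed_preimage _) fun z hz => ?_
  obtain ⟨e, he, hle⟩ := hS z
  have h1 := legendre_le_coe.1 hz e
  have h2 := hM e he
  rw [mem_closedBall_zero_iff, le_div_iff₀ hc]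
  linarith

lemma HasLimitingCGF.limsup_le [FiniteDimensional ℝ H]
    {Ω : Type*} [MeasurableSpace Ω] {P : Measure Ω} [IsProbabilityMeasure P]
    {Z : ℕ → Ω → H} {ν : ℕ → ℝ} {Λ : H → ℝ} (h : HasLimitingCGF P Z ν Λ) {F : Set H}
    (hF : IsClosed F) :
    limsup (fun n => (((ν n)⁻¹ : ℝ) : EReal) * ENNReal.log (P {ω | Z n ω ∈ F})) atTop ≤
      -(⨅ z ∈ F, legendre Λ z) :=
  limsup_inv_mul_log_le h.speed_tendsto fun _ hα =>
    h.upper_bound hF fun _ hz => coe_lt_legendre.1 (hα.trans_le (iInf₂_le _ hz))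

lemma HasLimitingCGF.le_liminf [FiniteDimensional ℝ H] [MeasurableSpace H] [BorelSpace H]
    {Ω : Type*} [MeasurableSpace Ω] {P : Measure Ω} [IsProbabilityMeasure P]
    {Z : ℕ → Ω → H} {ν : ℕ → ℝ} {Λ : H → ℝ} (h : HasLimitingCGF P Z ν Λ)
    (hZ : ∀ n, Measurable (Z n)) (hΛ : Differentiable ℝ Λ) {G : Set H} (hG : IsOpen G) :
    -(⨅ z ∈ G, legendre Λ z) ≤
      liminf (fun n => (((ν n)⁻¹ : ℝ) : EReal) * ENNReal.log (P {ω | Z n ω ∈ G})) atTop := by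
  refine le_liminf_inv_mul_log h.speed_tendsto fun b hb => ?_
  simp only [iInf_lt_iff] at hb
  obtain ⟨z, hz, hzb⟩ := hb
  obtain ⟨b', h1, h2⟩ := EReal.lt_iff_exists_real_btwn.1 hzb
  exact h.lower_bound hZ hΛ hG hz (legendre_le_coe.1 h1.le) (EReal.coe_lt_coe_iff.1 h2)

end Rates

/-! ### Exponential moments of the density and their continuity. -/

section Moments

/-- The Hilbert space carrying the pairs (numerator, denominator). -/
abbrev PairSpace (q : ℕ) : Type := WithLp 2 (Euc q × ℝ)

/-- The vector `(y, 1)`. -/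
def augment {q : ℕ} (y : Euc q) : PairSpace q := WithLp.toLp 2 (y, 1)

variable {d q : ℕ}

lemma inner_augment (θ : PairSpace q) (y : Euc q) :
    inner ℝ θ (augment y) = inner ℝ θ.fst y + θ.snd := by
  simp [augment, WithLp.prod_inner_apply]

lemma continuous_augment : Continuous (augment : Euc q → PairSpace q) :=
  (WithLp.prod_continuous_toLp 2 _ _).comp (by fun_prop)

lemma norm_augment_le (y : Euc q) : ‖augment y‖ ≤ 1 + ‖y‖ := by
  have h : ‖augment y‖ ^ 2 = ‖y‖ ^ 2 + 1 := by
    rw [WithLp.prod_norm_sq_eq_of_L2]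
    simp [augment]
  nlinarith [norm_nonneg y, norm_nonneg (augment y)]

lemma abs_inner_augment_le (θ : PairSpace q) (y : Euc q) :
    |inner ℝ θ (augment y)| ≤ ‖θ‖ * (1 + ‖y‖) :=
  (abs_real_inner_le_norm _ _).trans (by gcongr; exact norm_augment_le y)

lemma abs_exp_sub_one_le_mul (s : ℝ) : |Real.exp s - 1| ≤ |s| * Real.exp |s| := by
  have h1 := Real.add_one_le_exp s
  have h2 := Real.add_one_le_exp (-s)
  have h3 : Real.exp s * Real.exp (-s) = 1 := by rw [← Real.exp_add]; simp
  have h4 := Real.exp_pos s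
  have h5 : Real.exp s - 1 ≤ s * Real.exp s := by nlinarith
  rcases le_total 0 s with hs | hs
  · rw [abs_of_nonneg hs, abs_of_nonneg (by linarith)]
    exact h5
  · rw [abs_of_nonpos hs, abs_of_nonpos (by linarith [Real.exp_le_one_iff.2 hs])]
    nlinarith [Real.one_le_exp (neg_nonneg.2 hs)]

/-- The dominating function `exp (B (1 + ‖y‖))`. -/
def expDom (B : ℝ) (y : Euc q) : ℝ := Real.exp (B * (1 + ‖y‖))

lemma expDom_pos (B : ℝ) (y : Euc q) : 0 < expDom B y := Real.exp_pos _

lemma continuous_expDom (B : ℝ) : Continuous (expDom B : Euc q → ℝ) := by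
  unfold expDom; fun_prop

lemma norm_mul_expDom_le (B : ℝ) (y : Euc q) :
    (1 + ‖y‖) * expDom B y ≤ expDom (B + 1) y := by
  unfold expDom
  have h1 : (1 + ‖y‖) ≤ Real.exp (1 + ‖y‖) := by linarith [Real.add_one_le_exp (1 + ‖y‖)]
  calc (1 + ‖y‖) * Real.exp (B * (1 + ‖y‖)) ≤ Real.exp (1 + ‖y‖) * Real.exp (B * (1 + ‖y‖)) := by
        gcongr
    _ = _ := by rw [← Real.exp_add]; ring_nf

/-- A growth rate dominating all `exp (κ ⟪θ, (y, 1)⟫)`, `κ ∈ [0, C]`. -/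
def domRate (θ : PairSpace q) (C : ℝ) : ℝ := (C + 1) * ‖θ‖

lemma domRate_nonneg (θ : PairSpace q) {C : ℝ} (hC : 0 ≤ C) : 0 ≤ domRate θ C := by
  unfold domRate; positivity

lemma inner_mul_exp_le (θ : PairSpace q) {C : ℝ} (y : Euc q) :
    |inner ℝ θ (augment y)| * Real.exp (C * (‖θ‖ * (1 + ‖y‖))) ≤ expDom (domRate θ C) y := by
  have h0 := abs_inner_augment_le θ y
  have h1 : ‖θ‖ * (1 + ‖y‖) ≤ Real.exp (‖θ‖ * (1 + ‖y‖)) := by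
    linarith [Real.add_one_le_exp (‖θ‖ * (1 + ‖y‖))]
  calc |inner ℝ θ (augment y)| * Real.exp (C * (‖θ‖ * (1 + ‖y‖)))
      ≤ Real.exp (‖θ‖ * (1 + ‖y‖)) * Real.exp (C * (‖θ‖ * (1 + ‖y‖))) := by
        gcongr; exact h0.trans h1
    _ = _ := by unfold expDom domRate; rw [← Real.exp_add]; ring_nf

lemma abs_mul_inner_le (θ : PairSpace q) {C κ : ℝ} (hκ : 0 ≤ κ) (hC : 0 ≤ C) (y : Euc q) :
    |κ * inner ℝ θ (augment y)| ≤ κ * expDom (domRate θ C) y := by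
  rw [abs_mul, abs_of_nonneg hκ]
  gcongr
  refine le_trans ?_ (inner_mul_exp_le θ (C := C) y)
  exact le_mul_of_one_le_right (abs_nonneg _) (Real.one_le_exp (by positivity))

/-- The factor `κ` survives in the bound. With `κ = τ ^ ρ * K z` it cancels the singular `τ ^ (-ρ)`
and leaves the integrable `K z`. -/
lemma abs_exp_mul_inner_sub_one_le (θ : PairSpace q) {C κ : ℝ} (hκ : 0 ≤ κ) (hκC : κ ≤ C)
    (y : Euc q) :
    |Real.exp (κ * inner ℝ θ (augment y)) - 1| ≤ κ * expDom (domRate θ C) y := by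
  refine (abs_exp_sub_one_le_mul _).trans ?_
  rw [abs_mul, abs_of_nonneg hκ, mul_assoc]
  gcongr
  refine le_trans ?_ (inner_mul_exp_le θ (C := C) y)
  have := abs_inner_augment_le θ y
  gcongr
  exact hκ.trans hκC

variable {f : Euc d → Euc q → ℝ} {x : Euc d}

/-- The function `exp (B * ‖y‖)` is at most a finite sum of exponentials of linear forms, whose
moments are bounded in `t` by assumption. -/
lemma exists_integral_expDom_le (hfm : Measurable (fun p : Euc d × Euc q => f p.1 p.2))
    (hf0 : ∀ t y, 0 ≤ f t y) (hA : ExpMomentAssumption f x) {B : ℝ} (hB : 0 ≤ B) :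
    ∃ D : ℝ, 0 ≤ D ∧ ∀ t, Integrable (fun y => expDom B y * f t y) ∧
      ∫ y, expDom B y * f t y ≤ D := by
  obtain ⟨S, c, hc, hS⟩ := exists_finset_norm_le_inner (Euc q)
  choose M hM using hA.bounded
  have hle : ∀ t y, expDom B y * f t y ≤
      Real.exp B * ∑ e ∈ S, Real.exp (inner ℝ ((B / c) • e) y) * f t y := by
    intro t y
    obtain ⟨e, he, hle⟩ := hS y
    rw [← Finset.sum_mul, ← mul_assoc]
    refine mul_le_mul_of_nonneg_right ?_ (hf0 t y)
    unfold expDom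
    rw [mul_add, mul_one, Real.exp_add]
    gcongr
    refine le_trans ?_ (Finset.single_le_sum (f := fun e => Real.exp (inner ℝ ((B / c) • e) y))
      (fun _ _ => (Real.exp_pos _).le) he)
    apply Real.exp_le_exp.2
    rw [real_inner_smul_left]
    calc B * ‖y‖ = B / c * (c * ‖y‖) := by field_simp
      _ ≤ _ := by gcongr
  have hint : ∀ t, Integrable (fun y =>
      Real.exp B * ∑ e ∈ S, Real.exp (inner ℝ ((B / c) • e) y) * f t y) := fun t =>
    (integrable_finsetSum S fun e _ => hA.finite _ t).const_mul _
  have hint2 : ∀ t, Integrable (fun y => expDom B y * f t y) := by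
    intro t
    refine (hint t).mono' ?_ (Eventually.of_forall fun y => ?_)
    · exact ((continuous_expDom B).measurable.mul
        (hfm.comp measurable_prodMk_left)).aestronglyMeasurable
    · rw [Real.norm_of_nonneg (mul_nonneg (expDom_pos _ _).le (hf0 t y))]
      exact hle t y
  have hbd : ∀ t, ∫ y, expDom B y * f t y ≤ Real.exp B * ∑ e ∈ S, M ((B / c) • e) := by
    intro t
    refine (integral_mono (hint2 t) (hint t) (hle t)).trans ?_
    rw [integral_const_mul, integral_finsetSum S fun e _ => hA.finite _ t]
    gcongr with e he
    exact hM _ t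
  refine ⟨Real.exp B * ∑ e ∈ S, M ((B / c) • e), ?_, fun t => ⟨hint2 t, hbd t⟩⟩
  exact (integral_nonneg fun y => mul_nonneg (expDom_pos _ _).le (hf0 x y)).trans (hbd x)

/-- The function `(κ, t) ↦ ∫ (exp (κ (⟨u, y⟩ + v)) - 1) f(t, y) dy` for `θ = (u, v)`. -/
def compMoment (f : Euc d → Euc q → ℝ) (θ : PairSpace q) (κ : ℝ) (t : Euc d) : ℝ :=
  ∫ y, (Real.exp (κ * inner ℝ θ (augment y)) - 1) * f t y

lemma abs_compMoment_le (hf0 : ∀ t y, 0 ≤ f t y) {θ : PairSpace q} {C D κ : ℝ} {t : Euc d}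
    (hD : Integrable (fun y => expDom (domRate θ C) y * f t y) ∧
      ∫ y, expDom (domRate θ C) y * f t y ≤ D) (hκ : 0 ≤ κ) (hκC : κ ≤ C) :
    |compMoment f θ κ t| ≤ κ * D := by
  have h1 : ∀ y, ‖(Real.exp (κ * inner ℝ θ (augment y)) - 1) * f t y‖ ≤
      κ * (expDom (domRate θ C) y * f t y) := by
    intro y
    rw [norm_mul, Real.norm_eq_abs, Real.norm_of_nonneg (hf0 t y), ← mul_assoc]
    exact mul_le_mul_of_nonneg_right (abs_exp_mul_inner_sub_one_le θ hκ hκC y) (hf0 t y)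
  calc |compMoment f θ κ t| ≤ ∫ y, κ * (expDom (domRate θ C) y * f t y) :=
        norm_integral_le_of_norm_le (hD.1.const_mul κ) (Eventually.of_forall h1)
    _ ≤ κ * D := by
        rw [integral_const_mul]
        exact mul_le_mul_of_nonneg_left hD.2 hκ

lemma compMoment_eq (hA : ExpMomentAssumption f x) (θ : PairSpace q) (κ : ℝ) (t : Euc d) :
    compMoment f θ κ t =
      Real.exp (κ * θ.snd) * expMoment f (κ • θ.fst) t - expMoment f 0 t := by
  unfold compMoment expMoment
  rw [← integral_const_mul, ← integral_sub ((hA.finite _ t).const_mul _) (hA.finite 0 t)]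
  congr 1
  ext y
  rw [inner_augment, mul_add, Real.exp_add, real_inner_smul_left, inner_zero_left, Real.exp_zero]
  ring

lemma continuousOn_expMoment_smul (hfm : Measurable (fun p : Euc d × Euc q => f p.1 p.2))
    (hf0 : ∀ t y, 0 ≤ f t y) (hA : ExpMomentAssumption f x) (u : Euc q) (C : ℝ) :
    ContinuousOn (fun κ : ℝ => expMoment f (κ • u) x) (Set.Icc 0 C) := by
  rcases lt_or_ge C 0 with hC | hC
  · simp [Set.Icc_eq_empty (not_le.2 hC)]
  obtain ⟨D, -, hD⟩ := exists_integral_expDom_le hfm hf0 hA (B := C * ‖u‖) (by positivity)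
  refine continuousOn_of_dominated (bound := fun y => expDom (C * ‖u‖) y * f x y) ?_ ?_
    (hD x).1 ?_
  · exact fun κ _ => (hA.finite _ x).aestronglyMeasurable
  · intro κ hκ
    refine Eventually.of_forall fun y => ?_
    rw [norm_mul, Real.norm_of_nonneg (Real.exp_pos _).le, Real.norm_of_nonneg (hf0 x y)]
    refine mul_le_mul_of_nonneg_right (Real.exp_le_exp.2 ?_) (hf0 x y)
    rw [real_inner_smul_left]
    have h1 : inner ℝ u y ≤ ‖u‖ * (1 + ‖y‖) :=
      (real_inner_le_norm u y).trans (by gcongr; linarith)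
    calc κ * inner ℝ u y ≤ κ * (‖u‖ * (1 + ‖y‖)) := mul_le_mul_of_nonneg_left h1 hκ.1
      _ ≤ C * (‖u‖ * (1 + ‖y‖)) := by gcongr; exact hκ.2
      _ = _ := by ring
  · refine Eventually.of_forall fun y => Continuous.continuousOn ?_
    fun_prop

/-- Moving `t` to `x` while `κ` varies uses the uniform continuity assumption; moving `κ` at fixed
`x` uses dominated convergence. -/
lemma tendsto_expMoment_smul (hfm : Measurable (fun p : Euc d × Euc q => f p.1 p.2))
    (hf0 : ∀ t y, 0 ≤ f t y) (hA : ExpMomentAssumption f x)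
    (hA' : UniformExpMomentAssumption f x) (u : Euc q) {C : ℝ} {κs : ℕ → ℝ} {ts : ℕ → Euc d}
    {κ : ℝ} (hκs : ∀ᶠ n in atTop, κs n ∈ Set.Icc 0 C) (hκ : κ ∈ Set.Icc 0 C)
    (hκl : Tendsto κs atTop (𝓝 κ)) (htl : Tendsto ts atTop (𝓝 x)) :
    Tendsto (fun n => expMoment f (κs n • u) (ts n)) atTop (𝓝 (expMoment f (κ • u) x)) := by
  have h1 : Tendsto (fun n => expMoment f (κs n • u) x) atTop (𝓝 (expMoment f (κ • u) x)) :=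
    (continuousOn_expMoment_smul hfm hf0 hA u C κ hκ).tendsto.comp
      (tendsto_nhdsWithin_iff.2 ⟨hκl, hκs⟩)
  have h2 : Tendsto (fun n => expMoment f (κs n • u) (ts n) - expMoment f (κs n • u) x) atTop
      (𝓝 0) := by
    rw [Metric.tendsto_nhds]
    intro ε hε
    -- Writing `κ • u = α • (C + 1) • u` with `α = κ / (C + 1) ∈ [0, 1]`; `C + 1` avoids a division
    -- by zero.
    obtain ⟨δ, hδ, hδε⟩ := hA' ((C + 1) • u) ε hε
    filter_upwards [hκs, Metric.tendsto_nhds.1 htl δ hδ] with n hn hd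
    have hC : 0 < C + 1 := by linarith [hn.1.trans hn.2]
    have := hδε (ts n) hd (κs n / (C + 1)) ⟨div_nonneg hn.1 hC.le, by
      rw [div_le_one hC]; linarith [hn.2]⟩
    rw [smul_smul, div_mul_cancel₀ _ hC.ne'] at this
    simpa [Real.dist_eq] using this
  simpa using h2.add h1

lemma tendsto_compMoment (hfm : Measurable (fun p : Euc d × Euc q => f p.1 p.2))
    (hf0 : ∀ t y, 0 ≤ f t y) (hA : ExpMomentAssumption f x)
    (hA' : UniformExpMomentAssumption f x) (θ : PairSpace q) {C : ℝ} {κs : ℕ → ℝ}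
    {ts : ℕ → Euc d} {κ : ℝ} (hκs : ∀ᶠ n in atTop, κs n ∈ Set.Icc 0 C) (hκ : κ ∈ Set.Icc 0 C)
    (hκl : Tendsto κs atTop (𝓝 κ)) (htl : Tendsto ts atTop (𝓝 x)) :
    Tendsto (fun n => compMoment f θ (κs n) (ts n)) atTop (𝓝 (compMoment f θ κ x)) := by
  simp_rw [compMoment_eq hA]
  refine Tendsto.sub (Tendsto.mul ?_
    (tendsto_expMoment_smul hfm hf0 hA hA' θ.fst hκs hκ hκl htl)) ?_
  · exact (Real.continuous_exp.tendsto _).comp (hκl.mul_const _)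
  · exact (hA.continuousAt 0).tendsto.comp htl

lemma measurable_compMoment (hfm : Measurable (fun p : Euc d × Euc q => f p.1 p.2))
    (θ : PairSpace q) : Measurable (fun p : ℝ × Euc d => compMoment f θ p.1 p.2) := by
  have h1 : Measurable (fun r : (ℝ × Euc d) × Euc q =>
      (Real.exp (r.1.1 * inner ℝ θ (augment r.2)) - 1) * f r.1.2 r.2) := by
    have h2 : Measurable (fun r : (ℝ × Euc d) × Euc q => f r.1.2 r.2) :=
      hfm.comp ((measurable_snd.comp measurable_fst).prodMk measurable_snd)
    have h3 : Continuous (fun r : (ℝ × Euc d) × Euc q =>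
        Real.exp (r.1.1 * inner ℝ θ (augment r.2)) - 1) := by
      have := continuous_augment (q := q)
      fun_prop
    exact h3.measurable.mul h2
  exact (h1.stronglyMeasurable.integral_prod_right' (ν := volume)).measurable

end Moments

/-! ### Exponential moments of a single observation. -/

section Sample

variable {d q : ℕ} {f : Euc d → Euc q → ℝ} {x : Euc d} {K : Euc d → ℝ}

lemma integral_comp_inv_smul_sub (x : Euc d) {h : ℝ} (hh : 0 < h) (G : Euc d → ℝ) :
    ∫ t, G (h⁻¹ • (x - t)) = h ^ d * ∫ z, G z := by
  rw [integral_sub_left_eq_self (fun t => G (h⁻¹ • t)) volume x,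
    Measure.integral_comp_inv_smul volume G h, finrank_euclideanSpace_fin,
    abs_of_pos (by positivity), smul_eq_mul]

lemma integrable_comp_inv_smul_sub (x : Euc d) {h : ℝ} (hh : 0 < h) {G : Euc d → ℝ}
    (hG : Integrable G) : Integrable (fun t => G (h⁻¹ • (x - t))) :=
  (hG.comp_smul (inv_ne_zero hh.ne')).comp_sub_left x

lemma measurable_kernel_comp (hKm : Measurable K) (x : Euc d) (h : ℝ) :
    Measurable (fun t => K (h⁻¹ • (x - t))) := by
  refine hKm.comp (Continuous.measurable ?_)
  fun_prop

lemma integrable_kernel_mul_expDom (hfm : Measurable (fun p : Euc d × Euc q => f p.1 p.2))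
    (hf0 : ∀ t y, 0 ≤ f t y) (hK : KernelAssumption K) (hK0 : ∀ z, 0 ≤ K z) {B D : ℝ}
    (hD : ∀ t, Integrable (fun y => expDom B y * f t y) ∧ ∫ y, expDom B y * f t y ≤ D)
    {h : ℝ} (hh : 0 < h) :
    Integrable (fun p : Euc d × Euc q =>
      K (h⁻¹ • (x - p.1)) * expDom B p.2 * f p.1 p.2) ∧
    ∫ p : Euc d × Euc q, K (h⁻¹ • (x - p.1)) * expDom B p.2 * f p.1 p.2 ≤ h ^ d * D := by
  have hm : Measurable (fun p : Euc d × Euc q =>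
      K (h⁻¹ • (x - p.1)) * expDom B p.2 * f p.1 p.2) :=
    (((measurable_kernel_comp hK.measurable x h).comp measurable_fst).mul
      ((continuous_expDom B).measurable.comp measurable_snd)).mul hfm
  have hslice : ∀ t, ∫ y, K (h⁻¹ • (x - t)) * expDom B y * f t y =
      K (h⁻¹ • (x - t)) * ∫ y, expDom B y * f t y := by
    intro t
    rw [← integral_const_mul]
    simp_rw [mul_assoc]
  have hle : ∀ t, ∫ y, K (h⁻¹ • (x - t)) * expDom B y * f t y ≤ K (h⁻¹ • (x - t)) * D := by
    intro t
    rw [hslice]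
    exact mul_le_mul_of_nonneg_left (hD t).2 (hK0 _)
  have hnn : ∀ t y, 0 ≤ K (h⁻¹ • (x - t)) * expDom B y * f t y := fun t y =>
    mul_nonneg (mul_nonneg (hK0 _) (expDom_pos _ _).le) (hf0 t y)
  have hKh := (integrable_comp_inv_smul_sub x hh hK.integrable).mul_const D
  have hint : Integrable (fun p : Euc d × Euc q =>
      K (h⁻¹ • (x - p.1)) * expDom B p.2 * f p.1 p.2) := by
    rw [Measure.volume_eq_prod, integrable_prod_iff hm.aestronglyMeasurable]
    refine ⟨Eventually.of_forall fun t => ?_, ?_⟩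
    · simp_rw [mul_assoc]
      exact (hD t).1.const_mul _
    · simp_rw [Real.norm_of_nonneg (hnn _ _)]
      refine hKh.mono' ?_ (Eventually.of_forall fun t => ?_)
      · exact (hm.stronglyMeasurable.integral_prod_right').aestronglyMeasurable
      · rw [Real.norm_of_nonneg (integral_nonneg (hnn t))]
        exact hle t
  refine ⟨hint, ?_⟩
  rw [Measure.volume_eq_prod] at hint ⊢
  rw [integral_prod _ hint]
  refine (integral_mono hint.integral_prod_left hKh hle).trans ?_
  rw [integral_mul_const, integral_comp_inv_smul_sub x hh K, hK.integral_eq_one, mul_one]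

variable {Ω : Type*} [MeasurableSpace Ω] {P : Measure Ω} {X : ℕ → Ω → Euc d} {Y : ℕ → Ω → Euc q}

lemma IsIIDSampleWithDensity.measurable_pair (hs : IsIIDSampleWithDensity P X Y f) (i : ℕ) :
    Measurable (fun ω => (X i ω, Y i ω)) :=
  (hs.measurable_X i).prodMk (hs.measurable_Y i)

lemma IsIIDSampleWithDensity.integrable_comp_iff (hs : IsIIDSampleWithDensity P X Y f)
    {g : Euc d × Euc q → ℝ} (hg : Measurable g) (i : ℕ) :
    Integrable (fun ω => g (X i ω, Y i ω)) P ↔ Integrable (fun p => g p * f p.1 p.2) := by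
  have h1 := integrable_map_measure (μ := P) (f := fun ω => (X i ω, Y i ω)) (g := g)
    hg.aestronglyMeasurable (hs.measurable_pair i).aemeasurable
  rw [hs.law, integrable_withDensity_iff_integrable_smul' hs.density_measurable.ennreal_ofReal
    (by simp)] at h1
  refine h1.symm.trans (iff_of_eq (congrArg (Integrable · _) ?_))
  ext p
  rw [ENNReal.toReal_ofReal (hs.density_nonneg _ _), smul_eq_mul, mul_comm]

lemma IsIIDSampleWithDensity.integral_comp (hs : IsIIDSampleWithDensity P X Y f)
    {g : Euc d × Euc q → ℝ} (hg : Measurable g) (i : ℕ) :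
    ∫ ω, g (X i ω, Y i ω) ∂P = ∫ p : Euc d × Euc q, g p * f p.1 p.2 := by
  have h1 := integral_map (μ := P) (φ := fun ω => (X i ω, Y i ω)) (f := g)
    (hs.measurable_pair i).aemeasurable hg.aestronglyMeasurable
  rw [hs.law, integral_withDensity_eq_integral_toReal_smul hs.density_measurable.ennreal_ofReal
    (by simp)] at h1
  rw [← h1]
  congr 1
  ext p
  rw [ENNReal.toReal_ofReal (hs.density_nonneg _ _), smul_eq_mul, mul_comm]

/-- The weighted linear functional of one observation. -/
def kernelTerm (K : Euc d → ℝ) (x : Euc d) (θ : PairSpace q) (h : ℝ) (p : Euc d × Euc q) : ℝ :=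
  K (h⁻¹ • (x - p.1)) * inner ℝ θ (augment p.2)

lemma measurable_kernelTerm (hKm : Measurable K) (θ : PairSpace q) (h : ℝ) :
    Measurable (kernelTerm K x θ h) := by
  refine ((measurable_kernel_comp hKm x h).comp measurable_fst).mul (Continuous.measurable ?_)
  have := continuous_augment (q := q)
  fun_prop

/-- After rescaling, the moment differs from `1` by a term of order `h ^ d`. The bound on the
logarithm keeps the factor `w * h ^ d`, which later cancels the normalisation exactly and provides
domination uniform in the index. -/
lemma exp_mul_kernelTerm_moment [IsProbabilityMeasure P] (hs : IsIIDSampleWithDensity P X Y f)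
    (hK : KernelAssumption K) (hK0 : ∀ z, 0 ≤ K z) {C : ℝ} (hKC : ∀ z, K z ≤ C)
    (θ : PairSpace q) {D : ℝ}
    (hD : ∀ t, Integrable (fun y => expDom (domRate θ C) y * f t y) ∧
      ∫ y, expDom (domRate θ C) y * f t y ≤ D)
    (i : ℕ) {h w : ℝ} (hh : 0 < h) (hw0 : 0 ≤ w) (hw1 : w ≤ 1) :
    Integrable (fun ω => Real.exp (w * kernelTerm K x θ h (X i ω, Y i ω))) P ∧
    ∫ ω, Real.exp (w * kernelTerm K x θ h (X i ω, Y i ω)) ∂P =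
      1 + h ^ d * ∫ z, compMoment f θ (w * K z) (x - h • z) ∧
    |Real.log (∫ ω, Real.exp (w * kernelTerm K x θ h (X i ω, Y i ω)) ∂P)| ≤ w * (h ^ d * D) := by
  have hC : 0 ≤ C := (hK0 0).trans (hKC 0)
  have hfm := hs.density_measurable
  have hf0 := hs.density_nonneg
  obtain ⟨hdi, hdle⟩ := integrable_kernel_mul_expDom (x := x) hfm hf0 hK hK0 hD hh
  have hWm : Measurable (fun p => w * kernelTerm K x θ h p) :=
    (measurable_kernelTerm (q := q) hK.measurable θ h).const_mul w
  have hEm : Measurable (fun p => Real.exp (w * kernelTerm K x θ h p) - 1) :=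
    hWm.exp.sub_const 1
  have hκ0 : ∀ t : Euc d, 0 ≤ w * K (h⁻¹ • (x - t)) := fun t => mul_nonneg hw0 (hK0 _)
  have hκC : ∀ t : Euc d, w * K (h⁻¹ • (x - t)) ≤ C := fun t =>
    (mul_le_of_le_one_left (hK0 _) hw1).trans (hKC _)
  have hWle : ∀ p : Euc d × Euc q, ‖w * kernelTerm K x θ h p * f p.1 p.2‖ ≤
      w * (K (h⁻¹ • (x - p.1)) * expDom (domRate θ C) p.2 * f p.1 p.2) := by
    intro p
    rw [norm_mul, Real.norm_of_nonneg (hf0 _ _), ← mul_assoc, ← mul_assoc, Real.norm_eq_abs]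
    refine mul_le_mul_of_nonneg_right ?_ (hf0 _ _)
    rw [kernelTerm, ← mul_assoc]
    exact abs_mul_inner_le θ (hκ0 p.1) hC p.2
  have hEle : ∀ p : Euc d × Euc q,
      ‖(Real.exp (w * kernelTerm K x θ h p) - 1) * f p.1 p.2‖ ≤
      w * (K (h⁻¹ • (x - p.1)) * expDom (domRate θ C) p.2 * f p.1 p.2) := by
    intro p
    rw [norm_mul, Real.norm_of_nonneg (hf0 _ _), ← mul_assoc, ← mul_assoc, Real.norm_eq_abs]
    refine mul_le_mul_of_nonneg_right ?_ (hf0 _ _)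
    rw [kernelTerm, ← mul_assoc]
    exact abs_exp_mul_inner_sub_one_le θ (hκ0 p.1) (hκC p.1) p.2
  have hWi := (hdi.const_mul w).mono' (hWm.mul hfm).aestronglyMeasurable
    (Eventually.of_forall hWle)
  have hEi := (hdi.const_mul w).mono' (hEm.mul hfm).aestronglyMeasurable
    (Eventually.of_forall hEle)
  have hWP := (hs.integrable_comp_iff hWm i).2 hWi
  have hEP := (hs.integrable_comp_iff hEm i).2 hEi
  have hexpP : Integrable (fun ω => Real.exp (w * kernelTerm K x θ h (X i ω, Y i ω))) P := by
    refine (hEP.add (integrable_const (1 : ℝ))).congr (Eventually.of_forall fun ω => ?_)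
    simp
  have hbd : ∫ p : Euc d × Euc q,
      w * (K (h⁻¹ • (x - p.1)) * expDom (domRate θ C) p.2 * f p.1 p.2) ≤ w * (h ^ d * D) := by
    rw [integral_const_mul]
    exact mul_le_mul_of_nonneg_left hdle hw0
  have hWabs : |∫ ω, w * kernelTerm K x θ h (X i ω, Y i ω) ∂P| ≤ w * (h ^ d * D) := by
    rw [hs.integral_comp hWm i]
    exact (norm_integral_le_of_norm_le (hdi.const_mul w) (Eventually.of_forall hWle)).trans hbd
  have hEabs : |∫ ω, (Real.exp (w * kernelTerm K x θ h (X i ω, Y i ω)) - 1) ∂P| ≤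
      w * (h ^ d * D) := by
    rw [hs.integral_comp hEm i]
    exact (norm_integral_le_of_norm_le (hdi.const_mul w) (Eventually.of_forall hEle)).trans hbd
  have hsplit : ∫ ω, (Real.exp (w * kernelTerm K x θ h (X i ω, Y i ω)) - 1) ∂P =
      ∫ ω, Real.exp (w * kernelTerm K x θ h (X i ω, Y i ω)) ∂P - 1 := by
    rw [integral_sub hexpP (integrable_const _)]
    simp
  have hpos : 0 < ∫ ω, Real.exp (w * kernelTerm K x θ h (X i ω, Y i ω)) ∂P :=
    integral_exp_pos hexpP
  refine ⟨hexpP, ?_, abs_le.2 ⟨?_, ?_⟩⟩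
  · have h1 := hs.integral_comp hEm i
    rw [hsplit, Measure.volume_eq_prod, integral_prod _ (by rwa [← Measure.volume_eq_prod])] at h1
    have h2 : ∀ t, ∫ y, (Real.exp (w * kernelTerm K x θ h (t, y)) - 1) * f t y =
        (fun z => compMoment f θ (w * K z) (x - h • z)) (h⁻¹ • (x - t)) := by
      intro t
      simp only [compMoment, kernelTerm, smul_inv_smul₀ hh.ne', sub_sub_cancel, mul_assoc]
    simp only at h1
    rw [integral_congr_ae (Eventually.of_forall h2), 
      integral_comp_inv_smul_sub x hh (fun z => compMoment f θ (w * K z) (x - h • z))] at h1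
    linarith
  -- The lower bound comes from Jensen's inequality, through the tangent line of `exp` at the mean
  -- `m`. A bound by `1 - w * h ^ d * D` would not do, as this number may be negative.
  · set m := ∫ ω, w * kernelTerm K x θ h (X i ω, Y i ω) ∂P with hm
    have h1 : Real.exp m ≤ ∫ ω, Real.exp (w * kernelTerm K x θ h (X i ω, Y i ω)) ∂P := by
      have h2 : ∀ ω, Real.exp m * (1 + (w * kernelTerm K x θ h (X i ω, Y i ω) - m)) ≤
          Real.exp (w * kernelTerm K x θ h (X i ω, Y i ω)) := by
        intro ω
        have h3 := Real.add_one_le_exp (w * kernelTerm K x θ h (X i ω, Y i ω) - m)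
        calc _ ≤ Real.exp m * Real.exp (w * kernelTerm K x θ h (X i ω, Y i ω) - m) := by
              gcongr; linarith
          _ = _ := by rw [← Real.exp_add]; ring_nf
      have h4 : Integrable (fun ω => w * kernelTerm K x θ h (X i ω, Y i ω) - m) P :=
        hWP.sub (integrable_const _)
      have h5 := integral_mono (((integrable_const (1 : ℝ)).add h4).const_mul (Real.exp m))
        hexpP h2
      simp only [Pi.add_apply] at h5
      rw [integral_const_mul, integral_add (integrable_const _) h4,
        integral_sub hWP (integrable_const _), ← hm] at h5
      simpa using h5
    have := (Real.le_log_iff_exp_le hpos).2 h1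
    linarith [(abs_le.1 hWabs).1]
  · have := Real.log_le_sub_one_of_pos hpos
    linarith [(abs_le.1 hEabs).2]

end Sample

/-! ### Limits of averages and the integral form of Ψ̃. -/

section Limit

/-- Written as the integral of a step function, the average becomes accessible to dominated
convergence, without Riemann sum estimates near `τ = 0`. -/
lemma mean_eq_intervalIntegral_ceil (c : ℕ → ℝ) {n : ℕ} (hn : 1 ≤ n) :
    (1 / (n : ℝ)) * ∑ i ∈ Finset.Icc 1 n, c i = ∫ τ in (0 : ℝ)..1, c ⌈(n : ℝ) * τ⌉₊ := by
  have hn0 : (0 : ℝ) < n := by exact_mod_cast hn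
  let a : ℕ → ℝ := fun k => k / n
  have hle : ∀ k, a k ≤ a (k + 1) := by
    intro k
    simp only [a]
    gcongr
    simp
  have hceil : ∀ k, ∀ τ ∈ Set.Ioc (a k) (a (k + 1)), c (k + 1) = c ⌈(n : ℝ) * τ⌉₊ := by
    rintro k τ ⟨h1, h2⟩
    simp only [a] at h1 h2
    rw [div_lt_iff₀ hn0] at h1
    rw [le_div_iff₀ hn0] at h2
    congr 1
    symm
    rw [Nat.ceil_eq_iff (by simp)]
    push_cast at h2 ⊢
    constructor <;> linarith
  have hint : ∀ k < n, IntervalIntegrable (fun τ => c ⌈(n : ℝ) * τ⌉₊) volume (a k) (a (k + 1)) := by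
    intro k _
    rw [intervalIntegrable_iff_integrableOn_Ioc_of_le (hle k)]
    refine IntegrableOn.congr_fun (f := fun _ => c (k + 1)) ?_ (hceil k) measurableSet_Ioc
    exact integrableOn_const (by simp)
  have hsum := intervalIntegral.sum_integral_adjacent_intervals hint
  have ha0 : a 0 = 0 := by simp [a]
  have han : a n = 1 := by simp only [a]; field_simp
  rw [ha0, han] at hsum
  rw [← hsum, Finset.mul_sum]
  have hIcc : Finset.Icc 1 n = Finset.Ico (0 + 1) (n + 1) := by ext; simp
  rw [hIcc, ← Finset.sum_Ico_add' (fun i => 1 / (n : ℝ) * c i) 0 n 1, ← Finset.range_eq_Ico]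
  refine Finset.sum_congr rfl fun k _ => ?_
  rw [intervalIntegral.integral_of_le (hle k), ← setIntegral_congr_fun measurableSet_Ioc (hceil k),
    setIntegral_const, Real.volume_real_Ioc_of_le (hle k), smul_eq_mul]
  congr 1
  simp only [a]
  push_cast
  ring

/-- The inequalities `1 - 1 / s ≤ log s ≤ s - 1` squeeze the expression between `A / (1 + ε A)` and
`A`. -/
lemma tendsto_inv_mul_log_one_add {ε A : ℕ → ℝ} {A₀ : ℝ} (hε : Tendsto ε atTop (𝓝 0))
    (hε0 : ∀ᶠ n in atTop, 0 < ε n) (hA : Tendsto A atTop (𝓝 A₀)) :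
    Tendsto (fun n => (ε n)⁻¹ * Real.log (1 + ε n * A n)) atTop (𝓝 A₀) := by
  have h0 : Tendsto (fun n => 1 + ε n * A n) atTop (𝓝 1) := by
    simpa using (hε.mul hA).const_add 1
  have h1 : Tendsto (fun n => A n / (1 + ε n * A n)) atTop (𝓝 A₀) := by
    have := hA.div h0 one_ne_zero
    rw [div_one] at this
    exact this
  have hpos : ∀ᶠ n in atTop, 0 < 1 + ε n * A n := h0.eventually_const_lt one_pos
  refine tendsto_of_tendsto_of_tendsto_of_le_of_le' h1 hA ?_ ?_
  · filter_upwards [hε0, hpos] with n h2 h3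
    rw [le_inv_mul_iff₀ h2]
    refine le_trans (le_of_eq ?_) (Real.one_sub_inv_le_log_of_pos h3)
    field_simp
    ring
  · filter_upwards [hε0, hpos] with n h2 h3
    rw [inv_mul_le_iff₀ h2]
    linarith [Real.log_le_sub_one_of_pos h3]

variable {d q : ℕ} {f : Euc d → Euc q → ℝ} {x : Euc d} {K : Euc d → ℝ}

lemma tendsto_integral_compMoment (hfm : Measurable (fun p : Euc d × Euc q => f p.1 p.2))
    (hf0 : ∀ t y, 0 ≤ f t y) (hA : ExpMomentAssumption f x)
    (hA' : UniformExpMomentAssumption f x) (hK : KernelAssumption K) (hK0 : ∀ z, 0 ≤ K z)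
    {C : ℝ} (hKC : ∀ z, K z ≤ C) (θ : PairSpace q) {D : ℝ}
    (hD : ∀ t, Integrable (fun y => expDom (domRate θ C) y * f t y) ∧
      ∫ y, expDom (domRate θ C) y * f t y ≤ D)
    {w h : ℕ → ℝ} {w₀ : ℝ} (hw : ∀ᶠ n in atTop, w n ∈ Set.Icc 0 1) (hw0 : w₀ ∈ Set.Icc 0 1)
    (hwl : Tendsto w atTop (𝓝 w₀)) (hh : Tendsto h atTop (𝓝 0)) :
    Tendsto (fun n => ∫ z, compMoment f θ (w n * K z) (x - h n • z)) atTop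
      (𝓝 (∫ z, compMoment f θ (w₀ * K z) x)) := by
  have hκ : ∀ {v : ℝ} (z : Euc d), v ∈ Set.Icc 0 1 → v * K z ∈ Set.Icc 0 C := fun z hv =>
    ⟨mul_nonneg hv.1 (hK0 z), (mul_le_of_le_one_left (hK0 z) hv.2).trans (hKC z)⟩
  have hD0 : 0 ≤ D :=
    (integral_nonneg fun y => mul_nonneg (expDom_pos _ _).le (hf0 x y)).trans (hD x).2
  refine tendsto_integral_filter_of_dominated_convergence (fun z => K z * D) ?_ ?_
    (hK.integrable.mul_const D) ?_
  · refine Eventually.of_forall fun n => Measurable.aestronglyMeasurable ?_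
    refine (measurable_compMoment hfm θ).comp
      ((hK.measurable.const_mul (w n)).prodMk (Continuous.measurable ?_))
    fun_prop
  · filter_upwards [hw] with n hn
    refine Eventually.of_forall fun z => ?_
    refine (abs_compMoment_le hf0 (hD _) (hκ z hn).1 (hκ z hn).2).trans ?_
    gcongr
    exact mul_le_of_le_one_left (hK0 z) hn.2
  · refine Eventually.of_forall fun z => ?_
    refine tendsto_compMoment hfm hf0 hA hA' θ (C := C) (hw.mono fun n hn => hκ z hn) (hκ z hw0)
      (hwl.mul_const _) ?_
    simpa using (hh.smul_const z).const_sub x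

/-- The limiting cumulant generating function, on the space of pairs. -/
def pairPsi (a : ℝ) (K : Euc d → ℝ) (f : Euc d → Euc q → ℝ) (x : Euc d) (θ : PairSpace q) : ℝ :=
  semiRecPsi a K f x θ.fst θ.snd

/-- The integrand in the definition of the limiting cumulant generating function. -/
def psiIntegrand (ρ : ℝ) (K : Euc d → ℝ) (f : Euc d → Euc q → ℝ) (x : Euc d) (θ : PairSpace q)
    (p : ℝ × Euc d × Euc q) : ℝ :=
  p.1 ^ (-ρ) * (Real.exp (p.1 ^ ρ * inner ℝ θ (augment p.2.2) * K p.2.1) - 1) * f x p.2.2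

lemma pairPsi_eq (a : ℝ) (K : Euc d → ℝ) (f : Euc d → Euc q → ℝ) (x : Euc d) (θ : PairSpace q) :
    pairPsi a K f x θ = ∫ p in (Set.Icc (0 : ℝ) 1) ×ˢ (Set.univ : Set (Euc d × Euc q)),
      psiIntegrand (a * d) K f x θ p := by
  simp only [pairPsi, semiRecPsi, psiIntegrand, inner_augment]

lemma measurable_psiIntegrand (hfm : Measurable (fun p : Euc d × Euc q => f p.1 p.2))
    (hK : Measurable K) (ρ : ℝ) (θ : PairSpace q) : Measurable (psiIntegrand ρ K f x θ) := by
  have h1 : Measurable (fun p : ℝ × Euc d × Euc q => f x p.2.2) :=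
    (hfm.comp measurable_prodMk_left).comp (measurable_snd.comp measurable_snd)
  have h2 : Measurable (fun p : ℝ × Euc d × Euc q => inner ℝ θ (augment p.2.2)) := by
    refine Continuous.measurable ?_
    have := continuous_augment (q := q)
    fun_prop
  have h3 : Measurable (fun p : ℝ × Euc d × Euc q => K p.2.1) :=
    hK.comp (measurable_fst.comp measurable_snd)
  exact ((measurable_fst.pow_const _).mul
    ((((measurable_fst.pow_const _).mul h2).mul h3).exp.sub_const 1)).mul h1

lemma abs_psiIntegrand_le (hf0 : ∀ t y, 0 ≤ f t y) (hK0 : ∀ z, 0 ≤ K z) {C : ℝ}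
    (hKC : ∀ z, K z ≤ C) {ρ : ℝ} (hρ : 0 < ρ) (θ : PairSpace q) {p : ℝ × Euc d × Euc q}
    (hp : p.1 ∈ Set.Icc (0 : ℝ) 1) :
    ‖psiIntegrand ρ K f x θ p‖ ≤ K p.2.1 * (expDom (domRate θ C) p.2.2 * f x p.2.2) := by
  have hτ0 : 0 ≤ p.1 ^ ρ := Real.rpow_nonneg hp.1 _
  have hτ1 : p.1 ^ ρ ≤ 1 := Real.rpow_le_one hp.1 hp.2 hρ.le
  unfold psiIntegrand
  rw [norm_mul, norm_mul, Real.norm_of_nonneg (hf0 _ _), Real.rpow_neg hp.1,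
    Real.norm_of_nonneg (inv_nonneg.2 hτ0), Real.norm_eq_abs, ← mul_assoc]
  refine mul_le_mul_of_nonneg_right ?_ (hf0 _ _)
  have h1 := abs_exp_mul_inner_sub_one_le θ (C := C) (mul_nonneg hτ0 (hK0 p.2.1))
    ((mul_le_of_le_one_left (hK0 _) hτ1).trans (hKC _)) p.2.2
  calc (p.1 ^ ρ)⁻¹ * |Real.exp (p.1 ^ ρ * inner ℝ θ (augment p.2.2) * K p.2.1) - 1|
      ≤ (p.1 ^ ρ)⁻¹ * (p.1 ^ ρ * K p.2.1 * expDom (domRate θ C) p.2.2) := by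
        refine mul_le_mul_of_nonneg_left ?_ (inv_nonneg.2 hτ0)
        rwa [mul_right_comm (p.1 ^ ρ)]
    _ = ((p.1 ^ ρ)⁻¹ * p.1 ^ ρ) * (K p.2.1 * expDom (domRate θ C) p.2.2) := by ring
    -- Only an inequality: at `τ = 0` the product of the power and its inverse is `0`.
    _ ≤ 1 * (K p.2.1 * expDom (domRate θ C) p.2.2) := by
        refine mul_le_mul_of_nonneg_right inv_mul_le_one (mul_nonneg (hK0 _) (expDom_pos _ _).le)
    _ = _ := one_mul _

lemma integrableOn_kernel_dom (hK : Integrable K) {B : ℝ}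
    (hD : Integrable (fun y => expDom B y * f x y)) :
    IntegrableOn (fun p : ℝ × Euc d × Euc q => K p.2.1 * (expDom B p.2.2 * f x p.2.2))
      ((Set.Icc (0 : ℝ) 1) ×ˢ (Set.univ : Set (Euc d × Euc q))) := by
  have h1 : Integrable (fun p : Euc d × Euc q => K p.1 * (expDom B p.2 * f x p.2)) :=
    hK.mul_prod hD
  have h2 : Integrable (fun _ : ℝ => (1 : ℝ)) (volume.restrict (Set.Icc (0 : ℝ) 1)) :=
    integrable_const _
  have h3 := h2.mul_prod h1
  simp only [one_mul] at h3
  rw [IntegrableOn, Measure.volume_eq_prod ℝ, ← Measure.prod_restrict, Measure.restrict_univ]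
  exact h3

lemma integrableOn_psiIntegrand (hfm : Measurable (fun p : Euc d × Euc q => f p.1 p.2))
    (hf0 : ∀ t y, 0 ≤ f t y) (hK : KernelAssumption K) (hK0 : ∀ z, 0 ≤ K z) {C : ℝ}
    (hKC : ∀ z, K z ≤ C) {ρ : ℝ} (hρ : 0 < ρ) (θ : PairSpace q)
    (hD : Integrable (fun y => expDom (domRate θ C) y * f x y)) :
    IntegrableOn (psiIntegrand ρ K f x θ)
      ((Set.Icc (0 : ℝ) 1) ×ˢ (Set.univ : Set (Euc d × Euc q))) := by
  refine (integrableOn_kernel_dom hK.integrable hD).mono'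
    (measurable_psiIntegrand hfm hK.measurable ρ θ).aestronglyMeasurable ?_
  filter_upwards [ae_restrict_mem (measurableSet_Icc.prod MeasurableSet.univ)] with p hp
  exact abs_psiIntegrand_le hf0 hK0 hKC hρ θ hp.1

lemma pairPsi_eq_intervalIntegral (hfm : Measurable (fun p : Euc d × Euc q => f p.1 p.2))
    (hf0 : ∀ t y, 0 ≤ f t y) (hK : KernelAssumption K) (hK0 : ∀ z, 0 ≤ K z) {C : ℝ}
    (hKC : ∀ z, K z ≤ C) {a : ℝ} (hρ : 0 < a * d) (θ : PairSpace q)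
    (hD : Integrable (fun y => expDom (domRate θ C) y * f x y)) :
    pairPsi a K f x θ = ∫ τ in (0 : ℝ)..1,
      (τ ^ (a * d))⁻¹ * ∫ z, compMoment f θ (τ ^ (a * d) * K z) x := by
  have hint := integrableOn_psiIntegrand hfm hf0 hK hK0 hKC hρ θ hD
  rw [pairPsi_eq, Measure.volume_eq_prod ℝ, setIntegral_prod _ (by rwa [← Measure.volume_eq_prod]),
    intervalIntegral.integral_of_le zero_le_one, ← integral_Icc_eq_integral_Ioc]
  refine setIntegral_congr_fun measurableSet_Icc fun τ hτ => ?_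
  simp only [Measure.restrict_univ]
  have h1 : Integrable (fun p : Euc d × Euc q => psiIntegrand (a * d) K f x θ (τ, p)) := by
    have h2 : Integrable (fun p : Euc d × Euc q =>
      K p.1 * (expDom (domRate θ C) p.2 * f x p.2)) := hK.integrable.mul_prod hD
    refine h2.mono' ((measurable_psiIntegrand hfm hK.measurable _ θ).comp
      measurable_prodMk_left).aestronglyMeasurable (Eventually.of_forall fun p => ?_)
    exact abs_psiIntegrand_le hf0 hK0 hKC hρ θ (p := (τ, p)) hτ
  rw [Measure.volume_eq_prod] at h1 ⊢
  rw [integral_prod _ h1, ← integral_const_mul]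
  refine integral_congr_ae (Eventually.of_forall fun z => ?_)
  simp only [compMoment, psiIntegrand]
  rw [← integral_const_mul]
  refine integral_congr_ae (Eventually.of_forall fun y => ?_)
  simp only [Real.rpow_neg hτ.1]
  ring_nf

end Limit

/-! ### The limiting cumulant generating function of the pair. -/

section CGF

variable {d q : ℕ} {f : Euc d → Euc q → ℝ} {x : Euc d} {K : Euc d → ℝ}
  {Ω : Type*}
  {X : ℕ → Ω → Euc d} {Y : ℕ → Ω → Euc q} {h : ℕ → ℝ} {a c : ℝ}

/-- The pair (numerator, denominator) of the estimator. -/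
def semiRecPair (K : Euc d → ℝ) (h : ℕ → ℝ) (X : ℕ → Ω → Euc d)
    (Y : ℕ → Ω → Euc q) (x : Euc d) (n : ℕ) (ω : Ω) : PairSpace q :=
  WithLp.toLp 2 (semiRecNum K h X Y x n ω, semiRecDen K h X x n ω)

lemma speed_mul_inner_pair (θ : PairSpace q) (n : ℕ) (ω : Ω) :
    (n : ℝ) * h n ^ d * inner ℝ θ (semiRecPair K h X Y x n ω) =
      ∑ i ∈ Finset.Icc 1 n, h n ^ d / h i ^ d * kernelTerm K x θ (h i) (X i ω, Y i ω) := by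
  rcases Nat.eq_zero_or_pos n with rfl | hn
  · simp
  have hn0 : (n : ℝ) ≠ 0 := by positivity
  have h1 : inner ℝ θ (semiRecPair K h X Y x n ω) = (1 / (n : ℝ)) *
      ∑ i ∈ Finset.Icc 1 n, 1 / h i ^ d * kernelTerm K x θ (h i) (X i ω, Y i ω) := by
    simp only [semiRecPair, semiRecNum, semiRecDen, WithLp.prod_inner_apply, inner_smul_right,
      inner_sum, kernelTerm, mul_add, Finset.sum_add_distrib]
    congr 1
    · simp only [mul_assoc]
      rfl
    · simp only [RCLike.inner_apply, conj_trivial, mul_assoc, Finset.sum_mul, Finset.mul_sum,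
        augment, one_mul]
  rw [h1, Finset.mul_sum, Finset.mul_sum]
  refine Finset.sum_congr rfl fun i _ => ?_
  field_simp

variable [MeasurableSpace Ω] {P : Measure Ω}

lemma measurable_semiRecPair (hK : Measurable K) (hX : ∀ i, Measurable (X i))
    (hY : ∀ i, Measurable (Y i)) (n : ℕ) : Measurable (semiRecPair K h X Y x n) := by
  have h1 : ∀ i, Measurable fun ω => 1 / h i ^ d * K ((h i)⁻¹ • (x - X i ω)) := fun i =>
    ((measurable_kernel_comp hK x (h i)).comp (hX i)).const_mul _
  refine (WithLp.measurable_toLp 2 _).comp (Measurable.prodMk ?_ ?_)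
  · exact (Finset.measurable_fun_sum _ fun i _ => (h1 i).smul (hY i)).const_smul (1 / (n : ℝ))
  · exact (Finset.measurable_fun_sum _ fun i _ => h1 i).const_mul _

lemma bandwidth_pos (hc : 0 < c) (hh : ∀ n, 1 ≤ n → h n = c * (n : ℝ) ^ (-a)) {n : ℕ}
    (hn : 1 ≤ n) : 0 < h n := by
  rw [hh n hn]
  have : (0 : ℝ) < n := by exact_mod_cast hn
  positivity

lemma bandwidth_tendsto_zero (ha : 0 < a) (hh : ∀ n, 1 ≤ n → h n = c * (n : ℝ) ^ (-a)) :
    Tendsto h atTop (𝓝 0) := by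
  have h1 : Tendsto (fun n : ℕ => c * (n : ℝ) ^ (-a)) atTop (𝓝 (c * 0)) :=
    ((tendsto_rpow_neg_atTop ha).comp tendsto_natCast_atTop_atTop).const_mul c
  rw [mul_zero] at h1
  refine h1.congr' ?_
  filter_upwards [eventually_ge_atTop 1] with n hn
  rw [hh n hn]

lemma dim_pos (ha : 0 < a) (had : a < 1 / (d : ℝ)) : (0 : ℝ) < d := by
  rcases Nat.eq_zero_or_pos d with rfl | hd
  -- For `d = 0` the bound reads `a < 1 / 0 = 0`, against `0 < a`.
  · simp at had
    linarith
  · exact_mod_cast hd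

lemma speed_tendsto (hc : 0 < c) (ha : 0 < a) (had : a < 1 / (d : ℝ))
    (hh : ∀ n, 1 ≤ n → h n = c * (n : ℝ) ^ (-a)) :
    Tendsto (fun n : ℕ => (n : ℝ) * h n ^ d) atTop atTop := by
  have hd := dim_pos ha had
  have hρ : 0 < 1 - a * d := by
    rw [lt_div_iff₀ hd] at had
    linarith
  have h1 : Tendsto (fun n : ℕ => c ^ d * (n : ℝ) ^ (1 - a * d)) atTop atTop :=
    ((tendsto_rpow_atTop hρ).comp tendsto_natCast_atTop_atTop).const_mul_atTop (by positivity)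
  refine h1.congr' ?_
  filter_upwards [eventually_ge_atTop 1] with n hn
  have hn0 : (0 : ℝ) < n := by exact_mod_cast hn
  rw [hh n hn, mul_pow, ← Real.rpow_mul_natCast hn0.le, sub_eq_add_neg, Real.rpow_add hn0,
    Real.rpow_one, neg_mul]
  ring

lemma bandwidth_ratio (hc : 0 < c) (hh : ∀ n, 1 ≤ n → h n = c * (n : ℝ) ^ (-a)) {i n : ℕ}
    (hi : 1 ≤ i) (hn : 1 ≤ n) : h n ^ d / h i ^ d = ((i : ℝ) / n) ^ (a * d) := by
  have hn0 : (0 : ℝ) < n := by exact_mod_cast hn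
  have hi0 : (0 : ℝ) < i := by exact_mod_cast hi
  rw [hh n hn, hh i hi, ← div_pow, mul_div_mul_left _ _ hc.ne', Real.rpow_neg hn0.le,
    Real.rpow_neg hi0.le, inv_div_inv, ← Real.div_rpow hi0.le hn0.le,
    ← Real.rpow_mul_natCast (by positivity)]

/-- The contribution of the `i`-th observation to the scaled cumulant generating function. -/
def cgfTerm (P : Measure Ω) (K : Euc d → ℝ) (h : ℕ → ℝ) (X : ℕ → Ω → Euc d)
    (Y : ℕ → Ω → Euc q) (x : Euc d) (θ : PairSpace q) (n i : ℕ) : ℝ :=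
  (h n ^ d)⁻¹ * Real.log (∫ ω, Real.exp (h n ^ d / h i ^ d *
    kernelTerm K x θ (h i) (X i ω, Y i ω)) ∂P)

/-- The data shared by the lemmas on the limiting cumulant generating function. -/
structure KernelSetting (P : Measure Ω) (X : ℕ → Ω → Euc d) (Y : ℕ → Ω → Euc q)
    (f : Euc d → Euc q → ℝ) (K : Euc d → ℝ) (x : Euc d) (h : ℕ → ℝ) (a c C : ℝ) : Prop where
  sample : IsIIDSampleWithDensity P X Y f
  kernel : KernelAssumption K
  kernel_nonneg : ∀ z, 0 ≤ K z
  kernel_le : ∀ z, K z ≤ C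
  expMoment : ExpMomentAssumption f x
  uniform : UniformExpMomentAssumption f x
  c_pos : 0 < c
  a_pos : 0 < a
  a_lt : a < 1 / (d : ℝ)
  bandwidth : ∀ n, 1 ≤ n → h n = c * (n : ℝ) ^ (-a)

namespace KernelSetting

variable {C : ℝ}

lemma rho_pos (S : KernelSetting P X Y f K x h a c C) : 0 < a * d :=
  mul_pos S.a_pos (dim_pos S.a_pos S.a_lt)

lemma h_pos (S : KernelSetting P X Y f K x h a c C) {n : ℕ} (hn : 1 ≤ n) : 0 < h n :=
  bandwidth_pos S.c_pos S.bandwidth hn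

lemma C_nonneg (S : KernelSetting P X Y f K x h a c C) : 0 ≤ C :=
  (S.kernel_nonneg 0).trans (S.kernel_le 0)

lemma exists_domBound (S : KernelSetting P X Y f K x h a c C) (θ : PairSpace q) :
    ∃ D : ℝ, 0 ≤ D ∧ ∀ t, Integrable (fun y => expDom (domRate θ C) y * f t y) ∧
      ∫ y, expDom (domRate θ C) y * f t y ≤ D :=
  exists_integral_expDom_le S.sample.density_measurable S.sample.density_nonneg S.expMoment
    (domRate_nonneg θ S.C_nonneg)

lemma ratio_mem (S : KernelSetting P X Y f K x h a c C) {i n : ℕ} (hi : 1 ≤ i) (hin : i ≤ n) :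
    h n ^ d / h i ^ d ∈ Set.Icc (0 : ℝ) 1 := by
  have hn := hi.trans hin
  have hn0 : (0 : ℝ) < n := by exact_mod_cast hn
  rw [bandwidth_ratio S.c_pos S.bandwidth hi hn]
  refine ⟨by positivity, Real.rpow_le_one (by positivity) ?_ S.rho_pos.le⟩
  rw [div_le_one hn0]
  exact_mod_cast hin

variable [IsProbabilityMeasure P]

/-- The three powers cancel: `(h n ^ d)⁻¹ * (h n ^ d / h i ^ d) * h i ^ d = 1`, so `D` is uniform in
`i` and `n`. -/
lemma abs_cgfTerm_le (S : KernelSetting P X Y f K x h a c C) (θ : PairSpace q) {D : ℝ}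
    (hD : ∀ t, Integrable (fun y => expDom (domRate θ C) y * f t y) ∧
      ∫ y, expDom (domRate θ C) y * f t y ≤ D) {i n : ℕ} (hi : 1 ≤ i) (hin : i ≤ n) :
    |cgfTerm P K h X Y x θ n i| ≤ D := by
  have hin' := S.h_pos hi
  have hnn := S.h_pos (hi.trans hin)
  have hw := S.ratio_mem hi hin
  obtain ⟨-, -, h3⟩ := exp_mul_kernelTerm_moment (x := x) S.sample S.kernel S.kernel_nonneg
    S.kernel_le θ hD i hin' hw.1 hw.2
  rw [cgfTerm, abs_mul, abs_of_pos (by positivity), inv_mul_le_iff₀ (by positivity)]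
  refine h3.trans (le_of_eq ?_)
  field_simp

/-- For `i = ⌈n τ⌉` the term is `(h n ^ d / h i ^ d)⁻¹` times `(h i ^ d)⁻¹ * log (1 + h i ^ d * A)`;
the first factor tends to `τ ^ (-a d)`, the second to the limit of `A`, as `h i → 0`. -/
lemma tendsto_cgfTerm (S : KernelSetting P X Y f K x h a c C) (θ : PairSpace q) {τ : ℝ}
    (hτ : τ ∈ Set.Ioc (0 : ℝ) 1) :
    Tendsto (fun n : ℕ => cgfTerm P K h X Y x θ n ⌈(n : ℝ) * τ⌉₊) atTop
      (𝓝 ((τ ^ (a * d))⁻¹ * ∫ z, compMoment f θ (τ ^ (a * d) * K z) x)) := by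
  obtain ⟨D, hD0, hD⟩ := S.exists_domBound θ
  let i : ℕ → ℕ := fun n => ⌈(n : ℝ) * τ⌉₊
  have hi1 : ∀ n, 1 ≤ n → 1 ≤ i n := fun n hn => by
    have : (0 : ℝ) < n := by exact_mod_cast hn
    exact Nat.one_le_ceil_iff.2 (mul_pos this hτ.1)
  have hin : ∀ n, i n ≤ n := fun n => by
    refine Nat.ceil_le.2 (mul_le_of_le_one_right (Nat.cast_nonneg n) hτ.2)
  have hitop : Tendsto i atTop atTop :=
    tendsto_nat_ceil_atTop.comp (tendsto_natCast_atTop_atTop.atTop_mul_const hτ.1)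
  have hiτ : Tendsto (fun n => (i n : ℝ) / n) atTop (𝓝 τ) := by
    have := (tendsto_nat_ceil_mul_div_atTop hτ.1.le).comp
      (tendsto_natCast_atTop_atTop (R := ℝ))
    refine this.congr fun n => ?_
    simp only [Function.comp_apply, i, mul_comm]
  have hτρ : 0 < τ ^ (a * d) := Real.rpow_pos_of_pos hτ.1 _
  have hh0 := bandwidth_tendsto_zero S.a_pos S.bandwidth
  have hw : Tendsto (fun n => h n ^ d / h (i n) ^ d) atTop (𝓝 (τ ^ (a * d))) := by
    have h1 : Tendsto (fun n => ((i n : ℝ) / n) ^ (a * d)) atTop (𝓝 (τ ^ (a * d))) :=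
      hiτ.rpow_const (Or.inl hτ.1.ne')
    refine h1.congr' ?_
    filter_upwards [eventually_ge_atTop 1] with n hn
    rw [bandwidth_ratio S.c_pos S.bandwidth (hi1 n hn) hn]
  have hwmem : ∀ᶠ n in atTop, h n ^ d / h (i n) ^ d ∈ Set.Icc (0 : ℝ) 1 := by
    filter_upwards [eventually_ge_atTop 1] with n hn
    exact S.ratio_mem (hi1 n hn) (hin n)
  have hA := tendsto_integral_compMoment S.sample.density_measurable S.sample.density_nonneg
    S.expMoment S.uniform S.kernel S.kernel_nonneg S.kernel_le θ hD hwmem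
    ⟨hτρ.le, Real.rpow_le_one hτ.1.le hτ.2 S.rho_pos.le⟩ hw (hh0.comp hitop)
  have hd0 : d ≠ 0 := by
    have := dim_pos S.a_pos S.a_lt
    exact_mod_cast this.ne'
  have hε : Tendsto (fun n => h (i n) ^ d) atTop (𝓝 0) := by
    simpa [hd0] using (hh0.comp hitop).pow d
  have hεpos : ∀ᶠ n in atTop, 0 < h (i n) ^ d := by
    filter_upwards [eventually_ge_atTop 1] with n hn
    exact pow_pos (S.h_pos (hi1 n hn)) d
  refine ((hw.inv₀ hτρ.ne').mul (tendsto_inv_mul_log_one_add hε hεpos hA)).congr' ?_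
  filter_upwards [eventually_ge_atTop 1, hwmem, hεpos] with n hn hwn hin0
  obtain ⟨-, h2, -⟩ := exp_mul_kernelTerm_moment (x := x) S.sample S.kernel S.kernel_nonneg
    S.kernel_le θ hD (i n) (S.h_pos (hi1 n hn)) hwn.1 hwn.2
  change _ = cgfTerm P K h X Y x θ n (i n)
  rw [cgfTerm, h2, inv_div, div_mul_eq_mul_div, mul_inv_cancel_left₀ hin0.ne', inv_mul_eq_div]
  rfl

lemma integral_exp_speed_mul_inner (S : KernelSetting P X Y f K x h a c C) (θ : PairSpace q)
    (n : ℕ) :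
    Integrable (fun ω => Real.exp ((n : ℝ) * h n ^ d * inner ℝ θ (semiRecPair K h X Y x n ω))) P ∧
    ∫ ω, Real.exp ((n : ℝ) * h n ^ d * inner ℝ θ (semiRecPair K h X Y x n ω)) ∂P =
      ∏ i ∈ Finset.Icc 1 n, ∫ ω, Real.exp (h n ^ d / h i ^ d *
        kernelTerm K x θ (h i) (X i ω, Y i ω)) ∂P := by
  obtain ⟨D, hD0, hD⟩ := S.exists_domBound θ
  let W : ℕ → Ω → ℝ := fun i ω => h n ^ d / h i ^ d * kernelTerm K x θ (h i) (X i ω, Y i ω)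
  have hφ : ∀ i, Measurable fun p : Euc d × Euc q => h n ^ d / h i ^ d *
      kernelTerm K x θ (h i) p := fun i =>
    (measurable_kernelTerm S.kernel.measurable θ (h i)).const_mul _
  have hWm : ∀ i, Measurable (W i) := fun i => (hφ i).comp (S.sample.measurable_pair i)
  have hind : iIndepFun W P := S.sample.indep.comp (fun i p => h n ^ d / h i ^ d *
    kernelTerm K x θ (h i) p) hφ
  have hWi : ∀ i ∈ Finset.Icc 1 n, Integrable (fun ω => Real.exp (1 * W i ω)) P := by
    intro i hi
    rw [Finset.mem_Icc] at hi
    have hw := S.ratio_mem hi.1 hi.2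
    simp only [one_mul]
    exact (exp_mul_kernelTerm_moment (x := x) S.sample S.kernel S.kernel_nonneg
      S.kernel_le θ hD i (S.h_pos hi.1) hw.1 hw.2).1
  have hsum : ∀ ω, (n : ℝ) * h n ^ d * inner ℝ θ (semiRecPair K h X Y x n ω) =
      1 * (∑ i ∈ Finset.Icc 1 n, W i) ω := by
    intro ω
    rw [speed_mul_inner_pair, one_mul, Finset.sum_apply]
  simp_rw [hsum]
  refine ⟨hind.integrable_exp_mul_sum hWm hWi, ?_⟩
  have := hind.mgf_sum (t := 1) hWm (Finset.Icc 1 n)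
  simp only [mgf] at this
  rw [this]
  simp only [one_mul, W]

lemma scaled_cgf_eq (S : KernelSetting P X Y f K x h a c C) (θ : PairSpace q) {n : ℕ}
    (hn : 1 ≤ n) :
    ((n : ℝ) * h n ^ d)⁻¹ * Real.log
      (∫ ω, Real.exp ((n : ℝ) * h n ^ d * inner ℝ θ (semiRecPair K h X Y x n ω)) ∂P) =
    ∫ τ in (0 : ℝ)..1, cgfTerm P K h X Y x θ n ⌈(n : ℝ) * τ⌉₊ := by
  obtain ⟨D, hD0, hD⟩ := S.exists_domBound θ
  rw [(S.integral_exp_speed_mul_inner θ n).2, ← mean_eq_intervalIntegral_ceil _ hn, Real.log_prod,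
    mul_inv, Finset.mul_sum, Finset.mul_sum]
  · refine Finset.sum_congr rfl fun i _ => ?_
    rw [cgfTerm]
    ring
  · intro i hi
    rw [Finset.mem_Icc] at hi
    have hw := S.ratio_mem hi.1 hi.2
    exact (integral_exp_pos (exp_mul_kernelTerm_moment (x := x) S.sample S.kernel S.kernel_nonneg
      S.kernel_le θ hD i (S.h_pos hi.1) hw.1 hw.2).1).ne'

theorem hasLimitingCGF (S : KernelSetting P X Y f K x h a c C) :
    HasLimitingCGF P (semiRecPair K h X Y x) (fun n => (n : ℝ) * h n ^ d) (pairPsi a K f x) where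
  speed_tendsto := speed_tendsto S.c_pos S.a_pos S.a_lt S.bandwidth
  integrable θ n := (S.integral_exp_speed_mul_inner θ n).1
  tendsto θ := by
    obtain ⟨D, hD0, hD⟩ := S.exists_domBound θ
    rw [pairPsi_eq_intervalIntegral S.sample.density_measurable S.sample.density_nonneg S.kernel
      S.kernel_nonneg S.kernel_le S.rho_pos θ (hD x).1]
    have hlim : Tendsto (fun n : ℕ => ∫ τ in (0 : ℝ)..1, cgfTerm P K h X Y x θ n ⌈(n : ℝ) * τ⌉₊)
        atTop (𝓝 (∫ τ in (0 : ℝ)..1,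
          (τ ^ (a * d))⁻¹ * ∫ z, compMoment f θ (τ ^ (a * d) * K z) x)) := by
      refine intervalIntegral.tendsto_integral_filter_of_dominated_convergence (fun _ => D)
        (Eventually.of_forall fun n => ?_) ?_ (by simp) (Eventually.of_forall fun τ hτ => ?_)
      · have : Measurable fun τ : ℝ => cgfTerm P K h X Y x θ n ⌈(n : ℝ) * τ⌉₊ :=
          (measurable_from_nat (f := cgfTerm P K h X Y x θ n)).comp
            (Nat.measurable_ceil.comp (measurable_id.const_mul _))
        exact this.aestronglyMeasurable
      · filter_upwards [eventually_ge_atTop 1] with n hn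
        refine Eventually.of_forall fun τ hτ => ?_
        rw [Set.uIoc_of_le zero_le_one] at hτ
        have hn0 : (0 : ℝ) < n := by exact_mod_cast hn
        exact S.abs_cgfTerm_le θ hD (Nat.one_le_ceil_iff.2 (mul_pos hn0 hτ.1))
          (Nat.ceil_le.2 (mul_le_of_le_one_right hn0.le hτ.2))
      · rw [Set.uIoc_of_le zero_le_one] at hτ
        exact S.tendsto_cgfTerm θ hτ
    refine hlim.congr' ?_
    filter_upwards [eventually_ge_atTop 1] with n hn
    exact (S.scaled_cgf_eq θ hn).symm

end KernelSetting

end CGF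

/-! ### Differentiability of Ψ̃ and infinite cost of a nonpositive denominator. -/

section Rate

variable {d q : ℕ} {f : Euc d → Euc q → ℝ} {x : Euc d} {K : Euc d → ℝ}
  {Ω : Type*} [MeasurableSpace Ω] {P : Measure Ω}
  {X : ℕ → Ω → Euc d} {Y : ℕ → Ω → Euc q} {h : ℕ → ℝ} {a c C : ℝ}

/-- The product `p.1 ^ (-ρ) * p.1 ^ ρ` is not simplified to `1`, since it vanishes at `p.1 = 0` for
`ρ ≠ 0`. -/
lemma hasFDerivAt_psiIntegrand (ρ : ℝ) (p : ℝ × Euc d × Euc q) (θ : PairSpace q) :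
    HasFDerivAt (fun θ => psiIntegrand ρ K f x θ p)
      ((p.1 ^ (-ρ) * p.1 ^ ρ * Real.exp (p.1 ^ ρ * inner ℝ θ (augment p.2.2) * K p.2.1) *
        K p.2.1 * f x p.2.2) • innerSL ℝ (augment p.2.2)) θ := by
  have h1 : HasFDerivAt (fun θ : PairSpace q => inner ℝ θ (augment p.2.2))
      (innerSL ℝ (augment p.2.2)) θ := by
    refine (innerSL ℝ (augment p.2.2)).hasFDerivAt.congr_of_eventuallyEq
      (Eventually.of_forall fun w => ?_)
    exact real_inner_comm _ _
  have h2 := ((((h1.const_mul (p.1 ^ ρ)).mul_const (K p.2.1)).exp.sub_const 1).const_mul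
    (p.1 ^ (-ρ))).mul_const (f x p.2.2)
  refine h2.congr_fderiv ?_
  simp only [smul_smul]
  congr 1
  ring

lemma norm_fderiv_psiIntegrand_le (hf0 : ∀ t y, 0 ≤ f t y) (hK0 : ∀ z, 0 ≤ K z)
    (hKC : ∀ z, K z ≤ C) {ρ : ℝ} (hρ : 0 < ρ) {p : ℝ × Euc d × Euc q}
    (hp : p.1 ∈ Set.Icc (0 : ℝ) 1) {θ : PairSpace q} {T : ℝ} (hθ : ‖θ‖ ≤ T) :
    ‖(p.1 ^ (-ρ) * p.1 ^ ρ * Real.exp (p.1 ^ ρ * inner ℝ θ (augment p.2.2) * K p.2.1) *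
        K p.2.1 * f x p.2.2) • innerSL ℝ (augment p.2.2)‖ ≤
      K p.2.1 * (expDom (C * T + 1) p.2.2 * f x p.2.2) := by
  have hC : 0 ≤ C := (hK0 0).trans (hKC 0)
  have hτ0 : 0 ≤ p.1 ^ ρ := Real.rpow_nonneg hp.1 _
  have hτ1 : p.1 ^ ρ ≤ 1 := Real.rpow_le_one hp.1 hp.2 hρ.le
  have h1 : p.1 ^ (-ρ) * p.1 ^ ρ ≤ 1 := by rw [Real.rpow_neg hp.1]; exact inv_mul_le_one
  have h2 : Real.exp (p.1 ^ ρ * inner ℝ θ (augment p.2.2) * K p.2.1) ≤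
      expDom (C * T) p.2.2 := by
    apply Real.exp_le_exp.2
    have h3 : |inner ℝ θ (augment p.2.2)| ≤ T * (1 + ‖p.2.2‖) :=
      (abs_inner_augment_le θ p.2.2).trans (by gcongr)
    calc p.1 ^ ρ * inner ℝ θ (augment p.2.2) * K p.2.1
        ≤ |p.1 ^ ρ * inner ℝ θ (augment p.2.2) * K p.2.1| := le_abs_self _
      _ = p.1 ^ ρ * |inner ℝ θ (augment p.2.2)| * K p.2.1 := by
        rw [abs_mul, abs_mul, abs_of_nonneg hτ0, abs_of_nonneg (hK0 _)]
      _ ≤ 1 * (T * (1 + ‖p.2.2‖)) * C := by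
        gcongr
        · exact hK0 _
        · exact mul_nonneg zero_le_one ((abs_nonneg _).trans h3)
        · exact hKC _
      _ = _ := by ring
  have h4 := norm_mul_expDom_le (C * T) p.2.2
  have h5 := norm_augment_le p.2.2
  have h6 : 0 ≤ p.1 ^ (-ρ) * p.1 ^ ρ := mul_nonneg (Real.rpow_nonneg hp.1 _) hτ0
  rw [norm_smul, innerSL_apply_norm, Real.norm_of_nonneg (by
    have := hK0 p.2.1
    have := hf0 x p.2.2
    positivity)]
  have hKf : 0 ≤ K p.2.1 * f x p.2.2 := mul_nonneg (hK0 _) (hf0 _ _)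
  calc p.1 ^ (-ρ) * p.1 ^ ρ * Real.exp (p.1 ^ ρ * inner ℝ θ (augment p.2.2) * K p.2.1) *
        K p.2.1 * f x p.2.2 * ‖augment p.2.2‖
      = (p.1 ^ (-ρ) * p.1 ^ ρ) * Real.exp (p.1 ^ ρ * inner ℝ θ (augment p.2.2) * K p.2.1) *
        ‖augment p.2.2‖ * (K p.2.1 * f x p.2.2) := by ring
    _ ≤ 1 * expDom (C * T) p.2.2 * (1 + ‖p.2.2‖) * (K p.2.1 * f x p.2.2) := by
        have := (expDom_pos (C * T) p.2.2).le
        gcongr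
    _ = ((1 + ‖p.2.2‖) * expDom (C * T) p.2.2) * (K p.2.1 * f x p.2.2) := by ring
    _ ≤ expDom (C * T + 1) p.2.2 * (K p.2.1 * f x p.2.2) := by gcongr
    _ = _ := by ring

/-- The sets `{K > 1 / (k + 1)}` increase to a set of infinite measure, while each has finite
measure because `K` is integrable. -/
lemma exists_measure_kernel_gt (hK : Integrable K) (hKpos : volume {z : Euc d | 0 < K z} = ⊤)
    (R : ℝ) : ∃ η > 0, R < volume.real {z | η < K z} := by
  let s : ℕ → Set (Euc d) := fun k => {z | 1 / ((k : ℝ) + 1) < K z}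
  have hmono : Monotone s := by
    intro k l hkl z hz
    exact lt_of_le_of_lt (Nat.one_div_le_one_div hkl) (show 1 / ((k : ℝ) + 1) < K z from hz)
  have hU : ⋃ k, s k = {z | 0 < K z} := by
    ext z
    simp only [Set.mem_iUnion]
    constructor
    · rintro ⟨k, hk⟩
      exact lt_trans Nat.one_div_pos_of_nat (show 1 / ((k : ℝ) + 1) < K z from hk)
    · intro hz
      exact exists_nat_one_div_lt (show 0 < K z from hz)
  have hlim := tendsto_measure_iUnion_atTop (μ := volume) hmono
  rw [hU, hKpos] at hlim
  obtain ⟨k, hk⟩ := (hlim.eventually_const_lt (u := ENNReal.ofReal R) (by simp)).exists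
  refine ⟨1 / ((k : ℝ) + 1), Nat.one_div_pos_of_nat, ?_⟩
  by_contra! hle
  have hfin : volume (s k) ≠ ⊤ := (hK.measure_gt_lt_top Nat.one_div_pos_of_nat).ne
  refine absurd hk (not_lt.2 ?_)
  rw [Function.comp_apply, ← ofReal_measureReal hfin]
  exact ENNReal.ofReal_le_ofReal hle

namespace KernelSetting

lemma integrableOn_psi (S : KernelSetting P X Y f K x h a c C) (θ : PairSpace q) :
    IntegrableOn (psiIntegrand (a * d) K f x θ)
      ((Set.Icc (0 : ℝ) 1) ×ˢ (Set.univ : Set (Euc d × Euc q))) := by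
  obtain ⟨D, -, hD⟩ := S.exists_domBound θ
  exact integrableOn_psiIntegrand S.sample.density_measurable S.sample.density_nonneg S.kernel
    S.kernel_nonneg S.kernel_le S.rho_pos θ (hD x).1

lemma differentiable_pairPsi (S : KernelSetting P X Y f K x h a c C) :
    Differentiable ℝ (pairPsi a K f x : PairSpace q → ℝ) := by
  intro θ₀
  have hfm := S.sample.density_measurable
  have hf0 := S.sample.density_nonneg
  -- On the unit ball around `θ₀` norms are at most `‖θ₀‖ + 1`; the last `1` in the rate absorbs the
  -- factor `‖(y, 1)‖` of the derivative.
  have hT : 0 ≤ C * (‖θ₀‖ + 1) + 1 := by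
    have := S.C_nonneg
    positivity
  obtain ⟨D, -, hD⟩ := exists_integral_expDom_le hfm hf0 S.expMoment hT
  have hmem := ae_restrict_mem (μ := (volume : Measure (ℝ × Euc d × Euc q)))
    (measurableSet_Icc.prod MeasurableSet.univ :
      MeasurableSet ((Set.Icc (0 : ℝ) 1) ×ˢ (Set.univ : Set (Euc d × Euc q))))
  have key := hasFDerivAt_integral_of_dominated_of_fderiv_le (𝕜 := ℝ)
    (μ := (volume : Measure (ℝ × Euc d × Euc q)).restrict
      ((Set.Icc (0 : ℝ) 1) ×ˢ (Set.univ : Set (Euc d × Euc q))))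
    (F := fun θ p => psiIntegrand (a * d) K f x θ p)
    (F' := fun θ p => (p.1 ^ (-(a * d)) * p.1 ^ (a * d) *
        Real.exp (p.1 ^ (a * d) * inner ℝ θ (augment p.2.2) * K p.2.1) *
        K p.2.1 * f x p.2.2) • innerSL ℝ (augment p.2.2))
    (x₀ := θ₀) (Metric.ball_mem_nhds θ₀ one_pos)
    (bound := fun p => K p.2.1 * (expDom (C * (‖θ₀‖ + 1) + 1) p.2.2 * f x p.2.2))
    (Eventually.of_forall fun θ =>
      (measurable_psiIntegrand hfm S.kernel.measurable _ θ).aestronglyMeasurable)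
    (S.integrableOn_psi θ₀) ?_ ?_ (integrableOn_kernel_dom S.kernel.integrable (hD x).1)
    (Eventually.of_forall fun p θ _ => hasFDerivAt_psiIntegrand _ p θ)
  · refine key.differentiableAt.congr_of_eventuallyEq (Eventually.of_forall fun θ => ?_)
    exact pairPsi_eq a K f x θ
  · have hcont : Continuous (fun p : ℝ × Euc d × Euc q => innerSL ℝ (augment p.2.2)) :=
      (innerSL ℝ).continuous.comp (continuous_augment.comp (continuous_snd.comp continuous_snd))
    have h1 : Measurable (fun p : ℝ × Euc d × Euc q => f x p.2.2) :=
      (hfm.comp measurable_prodMk_left).comp (measurable_snd.comp measurable_snd)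
    have h2 : Measurable (fun p : ℝ × Euc d × Euc q => inner ℝ θ₀ (augment p.2.2)) := by
      refine Continuous.measurable ?_
      have := continuous_augment (q := q)
      fun_prop
    have h3 : Measurable (fun p : ℝ × Euc d × Euc q => K p.2.1) :=
      S.kernel.measurable.comp (measurable_fst.comp measurable_snd)
    have hcoef : Measurable (fun p : ℝ × Euc d × Euc q => p.1 ^ (-(a * d)) * p.1 ^ (a * d) *
        Real.exp (p.1 ^ (a * d) * inner ℝ θ₀ (augment p.2.2) * K p.2.1) *
        K p.2.1 * f x p.2.2) :=
      ((((measurable_fst.pow_const _).mul (measurable_fst.pow_const _)).mul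
        (((measurable_fst.pow_const _).mul h2).mul h3).exp).mul h3).mul h1
    exact hcoef.aestronglyMeasurable.smul hcont.aestronglyMeasurable
  · filter_upwards [hmem] with p hp θ hθ
    refine norm_fderiv_psiIntegrand_le hf0 S.kernel_nonneg S.kernel_le S.rho_pos hp.1 ?_
    have h1 : dist θ θ₀ < 1 := hθ
    have h2 := norm_le_norm_add_norm_sub θ₀ θ
    rw [dist_eq_norm, norm_sub_rev] at h1
    linarith

/-- For `v ≤ 0` the integrand is nonpositive. With `v = -2 / η` it is at most `-f(x, y) / 2` where
`τ ≥ 1 / 2` and `K > η`, so the integral is at most `-g(x) / 4` times the measure of `{K > η}`,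
which can be made arbitrarily large. -/
lemma exists_pairPsi_le (S : KernelSetting P X Y f K x h a c C)
    (hg : 0 < marginalDensity f x) (hKpos : volume {z : Euc d | 0 < K z} = ⊤) (R : ℝ) :
    ∃ v ≤ 0, pairPsi a K f x (WithLp.toLp 2 ((0 : Euc q), v)) ≤ -R := by
  have hf0 := S.sample.density_nonneg
  obtain ⟨η, hη, hηR⟩ := exists_measure_kernel_gt S.kernel.integrable hKpos
    (4 * R / marginalDensity f x)
  rw [div_lt_iff₀ hg] at hηR
  have hρ1 : a * d ≤ 1 := by
    have := S.a_lt
    rw [lt_div_iff₀ (dim_pos S.a_pos S.a_lt)] at this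
    exact this.le
  refine ⟨-(2 / η), by simpa using (div_pos two_pos hη).le, ?_⟩
  set θ : PairSpace q := WithLp.toLp 2 ((0 : Euc q), -(2 / η)) with hθ
  have hin : ∀ y, inner ℝ θ (augment y) = -(2 / η) := by
    intro y
    rw [inner_augment]
    simp [hθ]
  have hKη : MeasurableSet {z | η < K z} := measurableSet_lt measurable_const S.kernel.measurable
  let G : ℝ × Euc d × Euc q → ℝ := fun p => (Set.Icc (1 / 2 : ℝ) 1).indicator (fun _ => 1 / 2) p.1 *
    ({z | η < K z}.indicator (fun _ => 1) p.2.1 * f x p.2.2)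
  have hμ : (volume : Measure (ℝ × Euc d × Euc q)).restrict
      ((Set.Icc (0 : ℝ) 1) ×ˢ (Set.univ : Set (Euc d × Euc q))) =
      ((volume : Measure ℝ).restrict (Set.Icc 0 1)).prod
        ((volume : Measure (Euc d)).prod (volume : Measure (Euc q))) := by
    rw [Measure.volume_eq_prod ℝ, ← Measure.prod_restrict, Measure.restrict_univ,
      Measure.volume_eq_prod (Euc d)]
  have hfi : Integrable (f x) := by simpa using S.expMoment.finite 0 x
  have hi1 : Integrable ((Set.Icc (1 / 2 : ℝ) 1).indicator (fun _ => (1 / 2 : ℝ)))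
      ((volume : Measure ℝ).restrict (Set.Icc 0 1)) :=
    (integrable_const _).indicator measurableSet_Icc
  have hi2 : Integrable ({z | η < K z}.indicator (fun _ => (1 : ℝ))) := by
    rw [integrable_indicator_iff hKη]
    exact integrableOn_const (S.kernel.integrable.measure_gt_lt_top hη).ne
  have hGi : IntegrableOn G ((Set.Icc (0 : ℝ) 1) ×ˢ (Set.univ : Set (Euc d × Euc q))) := by
    rw [IntegrableOn, hμ]
    exact hi1.mul_prod (hi2.mul_prod hfi)
  have hGint : ∫ p in (Set.Icc (0 : ℝ) 1) ×ˢ (Set.univ : Set (Euc d × Euc q)), G p =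
      4⁻¹ * (volume.real {z | η < K z} * marginalDensity f x) := by
    rw [hμ, integral_prod_mul (μ := (volume : Measure ℝ).restrict (Set.Icc 0 1))
      (ν := (volume : Measure (Euc d)).prod (volume : Measure (Euc q)))
      (fun τ => (Set.Icc (1 / 2 : ℝ) 1).indicator (fun _ => (1 / 2 : ℝ)) τ)
      (fun p : Euc d × Euc q => {z | η < K z}.indicator (fun _ => (1 : ℝ)) p.1 * f x p.2),
      integral_prod_mul (μ := (volume : Measure (Euc d))) (ν := (volume : Measure (Euc q)))
      (fun z => {z | η < K z}.indicator (fun _ => (1 : ℝ)) z) (fun y => f x y),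
      integral_indicator_const _ hKη, integral_indicator_const _ measurableSet_Icc,
      measureReal_restrict_apply measurableSet_Icc,
      Set.inter_eq_left.2 (Set.Icc_subset_Icc_left (by norm_num)),
      Real.volume_real_Icc_of_le (by norm_num), marginalDensity]
    norm_num
  have hle : ∀ᵐ p ∂(volume : Measure (ℝ × Euc d × Euc q)).restrict
      ((Set.Icc (0 : ℝ) 1) ×ˢ (Set.univ : Set (Euc d × Euc q))),
      psiIntegrand (a * d) K f x θ p ≤ -G p := by
    filter_upwards [ae_restrict_mem (measurableSet_Icc.prod MeasurableSet.univ)] with p hp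
    have hp1 : p.1 ∈ Set.Icc (0 : ℝ) 1 := hp.1
    have hτ0 : 0 ≤ p.1 ^ (a * d) := Real.rpow_nonneg hp1.1 _
    have hKp := S.kernel_nonneg p.2.1
    have hfp := hf0 x p.2.2
    simp only [psiIntegrand, hin, G]
    have hexp : p.1 ^ (a * d) * -(2 / η) * K p.2.1 ≤ 0 := by
      have : 0 ≤ p.1 ^ (a * d) * (2 / η) * K p.2.1 := by positivity
      linarith
    by_cases h1 : p.1 ∈ Set.Icc (1 / 2 : ℝ) 1 ∧ η < K p.2.1
    · have hmem : p.2.1 ∈ {z | η < K z} := h1.2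
      have hpos : 0 < p.1 := by linarith [h1.1.1]
      rw [Set.indicator_of_mem h1.1, Set.indicator_of_mem hmem, one_mul,
        show -(1 / 2 * f x p.2.2) = -(1 / 2) * f x p.2.2 by ring]
      refine mul_le_mul_of_nonneg_right ?_ hfp
      have h2 : 1 / 2 ≤ p.1 ^ (a * d) := by
        calc 1 / 2 ≤ p.1 ^ (1 : ℝ) := by rw [Real.rpow_one]; exact h1.1.1
          _ ≤ p.1 ^ (a * d) := Real.rpow_le_rpow_of_exponent_ge hpos hp1.2 hρ1
      have h3 : 1 ≤ p.1 ^ (-(a * d)) := by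
        rw [Real.rpow_neg hp1.1]
        exact (one_le_inv₀ (by linarith)).2 (Real.rpow_le_one hp1.1 hp1.2 S.rho_pos.le)
      -- Since `a d ≤ 1`, `τ ^ (a d) ≥ τ ≥ 1 / 2`; with `K > η` the exponent is at most `-(1 / 2) *
      -- (2 / η) * η = -1`, and `exp (-1) < 1 / 2`.
      have h4 : p.1 ^ (a * d) * -(2 / η) * K p.2.1 ≤ -1 := by
        have : 1 ≤ p.1 ^ (a * d) * (2 / η) * K p.2.1 := by
          calc (1 : ℝ) = 1 / 2 * (2 / η) * η := by field_simp
            _ ≤ _ := by gcongr; exact h1.2.le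
        linarith
      have h5 : Real.exp (p.1 ^ (a * d) * -(2 / η) * K p.2.1) ≤ 1 / 2 := by
        refine (Real.exp_le_exp.2 h4).trans ?_
        have := Real.exp_neg_one_lt_half
        linarith
      nlinarith
    · have hG0 : (Set.Icc (1 / 2 : ℝ) 1).indicator (fun _ => (1 / 2 : ℝ)) p.1 *
          ({z | η < K z}.indicator (fun _ => (1 : ℝ)) p.2.1 * f x p.2.2) = 0 := by
        rcases not_and_or.1 h1 with h2 | h2
        · rw [Set.indicator_of_notMem h2, zero_mul]
        · have hmem : p.2.1 ∉ {z | η < K z} := h2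
          rw [Set.indicator_of_notMem hmem, zero_mul, mul_zero]
      rw [hG0, neg_zero]
      have h2 := Real.exp_le_one_iff.2 hexp
      exact mul_nonpos_of_nonpos_of_nonneg (mul_nonpos_of_nonneg_of_nonpos
        (Real.rpow_nonneg hp1.1 _) (by linarith)) hfp
  rw [pairPsi_eq]
  refine (integral_mono_ae (S.integrableOn_psi θ) hGi.neg hle).trans ?_
  rw [show (-G) = fun p => -G p from rfl, integral_neg, hGint]
  linarith

/-- Along `(0, v)` with `v ≤ 0` the linear term is nonnegative when `z.snd ≤ 0`, while `-Ψ̃(0, v)`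
is unbounded above. -/
lemma legendre_eq_top (S : KernelSetting P X Y f K x h a c C)
    (hg : 0 < marginalDensity f x) (hKpos : volume {z : Euc d | 0 < K z} = ⊤)
    {z : PairSpace q} (hz : z.snd ≤ 0) : legendre (pairPsi a K f x) z = ⊤ := by
  rw [EReal.eq_top_iff_forall_lt]
  intro y
  obtain ⟨v, hv, hle⟩ := S.exists_pairPsi_le hg hKpos (y + 1)
  refine coe_lt_legendre.2 ⟨WithLp.toLp 2 ((0 : Euc q), v), ?_⟩
  have h1 : inner ℝ (WithLp.toLp 2 ((0 : Euc q), v) : PairSpace q) z = z.snd * v := by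
    simp [WithLp.prod_inner_apply]
  have h2 : 0 ≤ z.snd * v := mul_nonneg_of_nonpos_of_nonpos hz hv
  rw [h1]
  linarith

end KernelSetting

lemma semiRecI_eq_legendre (a : ℝ) (K : Euc d → ℝ) (f : Euc d → Euc q → ℝ) (x : Euc d)
    (t₁ : Euc q) (t₂ : ℝ) :
    semiRecI a K f x t₁ t₂ = legendre (pairPsi a K f x) (WithLp.toLp 2 (t₁, t₂)) := by
  refine ((WithLp.equiv 2 (Euc q × ℝ)).symm.iSup_congr fun w => ?_)
  simp [WithLp.prod_inner_apply, pairPsi, mul_comm]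

end Rate

/-! ### Contraction of a rate function by the ratio. -/

section Ratio

variable {q : ℕ} {L : PairSpace q → EReal}

lemma continuousOn_ratio :
    ContinuousOn (fun z : PairSpace q => z.snd⁻¹ • z.fst) {z | z.snd ≠ 0} := by
  have h1 : Continuous fun z : PairSpace q => z.snd := by fun_prop
  have h2 : Continuous fun z : PairSpace q => z.fst := by fun_prop
  exact (h1.continuousOn.inv₀ fun _ hz => hz).smul h2.continuousOn

lemma isOpen_ratio_mem {U : Set (Euc q)} (hU : IsOpen U) :
    IsOpen {z : PairSpace q | z.snd ≠ 0 ∧ z.snd⁻¹ • z.fst ∈ U} := by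
  have h1 : Continuous fun z : PairSpace q => z.snd := by fun_prop
  exact continuousOn_ratio.isOpen_inter_preimage (isOpen_ne_fun h1 continuous_const) hU

lemma toLp_smul_ratio {z : PairSpace q} (hz : z.snd ≠ 0) :
    (WithLp.toLp 2 (z.snd • z.snd⁻¹ • z.fst, z.snd) : PairSpace q) = z := by
  rw [smul_inv_smul₀ hz]
  rfl

/-- If a good rate function on pairs is infinite when the second coordinate is not positive, the
contraction by the ratio is a good rate function. -/
theorem isGoodRateFunction_ratio (h0 : ∀ z, 0 ≤ L z) (hlsc : LowerSemicontinuous L)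
    (hcomp : ∀ α : ℝ, IsCompact {z | L z ≤ α}) (htop : ∀ z : PairSpace q, z.snd ≤ 0 → L z = ⊤) :
    IsGoodRateFunction
      (fun s : Euc q => ⨅ (t : ℝ) (_ : t ≠ 0), L (WithLp.toLp 2 (t • s, t))) := by
  set J : Euc q → EReal := fun s => ⨅ (t : ℝ) (_ : t ≠ 0), L (WithLp.toLp 2 (t • s, t)) with hJ
  have hJ0 : ∀ s, 0 ≤ J s := fun s => le_iInf₂ fun t _ => h0 _
  have hpos : ∀ {α : ℝ} {z : PairSpace q}, L z ≤ α → 0 < z.snd := by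
    intro α z hz
    by_contra! hneg
    rw [htop z hneg] at hz
    exact absurd hz (not_le.2 (EReal.coe_lt_top α))
  -- The infimum over `t` is attained, so the level sets of `J` are images of compact level sets of
  -- `L`, on which the second coordinate is positive and the ratio continuous.
  have hlevel : ∀ α : ℝ, {s | J s ≤ α} =
      (fun z : PairSpace q => z.snd⁻¹ • z.fst) '' {z | L z ≤ α} := by
    intro α
    ext s
    constructor
    · intro hs
      have hs' : J s ≤ α := hs
      let g : ℝ → PairSpace q := fun t => WithLp.toLp 2 (t • s, t)
      have hg : Continuous g := (WithLp.prod_continuous_toLp 2 _ _).comp (by fun_prop)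
      have hgl : LowerSemicontinuous fun t => L (g t) := fun t y hy =>
        hg.continuousAt.eventually (hlsc (g t) y hy)
      -- The level `α + 1` ensures that `T` is nonempty before attainment is known. Minimising over
      -- all `t`, zero included, is harmless: finiteness at the minimiser forces `t₀ > 0`.
      let T : Set ℝ := {t | L (g t) ≤ ((α + 1 : ℝ) : EReal)}
      have hTne : T.Nonempty := by
        have h1 : J s < ((α + 1 : ℝ) : EReal) :=
          hs'.trans_lt (EReal.coe_lt_coe_iff.2 (by linarith))
        simp only [hJ, iInf_lt_iff] at h1
        obtain ⟨t, -, ht⟩ := h1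
        exact ⟨t, ht.le⟩
      have hsnd : Continuous fun z : PairSpace q => z.snd := by fun_prop
      have hTc : IsCompact T := ((hcomp (α + 1)).image hsnd).of_isClosed_subset
        (hgl.isClosed_preimage _) fun t ht => ⟨g t, ht, rfl⟩
      obtain ⟨t₀, ht₀, hmin⟩ :=
        LowerSemicontinuousOn.exists_isMinOn hTne hTc (hgl.lowerSemicontinuousOn T)
      have hle : L (g t₀) ≤ J s := by
        refine le_iInf₂ fun t _ => ?_
        by_cases ht : t ∈ T
        · exact hmin ht
        · have ht' : ((α + 1 : ℝ) : EReal) < L (g t) := not_le.1 ht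
          exact le_trans ht₀ ht'.le
      have hα : L (g t₀) ≤ α := hle.trans hs'
      have ht0 : 0 < t₀ := hpos hα
      exact ⟨g t₀, hα, inv_smul_smul₀ ht0.ne' s⟩
    · rintro ⟨z, hz, rfl⟩
      have hz' : L z ≤ α := hz
      have hz0 := (hpos hz').ne'
      change (⨅ (t : ℝ) (_ : t ≠ 0), L (WithLp.toLp 2 (t • z.snd⁻¹ • z.fst, t))) ≤ α
      refine (iInf₂_le z.snd hz0).trans ?_
      rwa [toLp_smul_ratio hz0]
  have hcpt : ∀ α : ℝ, IsCompact {s | J s ≤ α} := by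
    intro α
    rw [hlevel]
    exact (hcomp α).image_of_continuousOn
      (continuousOn_ratio.mono fun z hz => (hpos (α := α) hz).ne')
  refine ⟨hJ0, lowerSemicontinuous_iff_isClosed_preimage.2 fun y => ?_, hcpt⟩
  induction y with
  | bot =>
    have : J ⁻¹' Set.Iic ⊥ = ∅ := by
      ext s
      simp only [Set.mem_preimage, Set.mem_Iic, le_bot_iff, Set.mem_empty_iff_false, iff_false]
      intro hs
      have := hJ0 s
      rw [hs] at this
      simp at this
    rw [this]
    exact isClosed_empty
  | top => simp
  | coe α => exact (hcpt α).isClosed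

end Ratio

/-! ### The large deviations principle for the estimator. -/

section LDP

variable {d q : ℕ} {f : Euc d → Euc q → ℝ} {x : Euc d} {K : Euc d → ℝ}
  {Ω : Type*} [MeasurableSpace Ω] {P : Measure Ω}
  {X : ℕ → Ω → Euc d} {Y : ℕ → Ω → Euc q} {h : ℕ → ℝ} {a c C : ℝ}

lemma KernelSetting.semiRecJ_eq (S : KernelSetting P X Y f K x h a c C)
    (hg : 0 < marginalDensity f x) (hKpos : volume {z : Euc d | 0 < K z} = ⊤) :
    semiRecJ a K f x = fun s =>
      ⨅ (t : ℝ) (_ : t ≠ 0), legendre (pairPsi a K f x) (WithLp.toLp 2 (t • s, t)) := by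
  ext s
  have htop : semiRecI a K f x 0 0 = ⊤ := by
    rw [semiRecI_eq_legendre]
    exact S.legendre_eq_top hg hKpos le_rfl
  rw [semiRecJ, htop, inf_top_eq, semiRecJStar]
  simp_rw [semiRecI_eq_legendre]

theorem KernelSetting.satisfiesLDP [IsProbabilityMeasure P]
    (S : KernelSetting P X Y f K x h a c C)
    (hg : 0 < marginalDensity f x) (hKpos : volume {z : Euc d | 0 < K z} = ⊤) :
    SatisfiesLDP P (semiRecEstimator K h X Y x) (fun n => (n : ℝ) * h n ^ d)
      (semiRecJ a K f x) where
  speed_pos n hn := by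
    have h1 := S.h_pos hn
    have h2 : (0 : ℝ) < n := by exact_mod_cast hn
    positivity
  speed_tendsto := S.hasLimitingCGF.speed_tendsto
  lower U hU := by
    have hspeed := S.hasLimitingCGF.speed_tendsto
    have hmeas := measurable_semiRecPair (h := h) (x := x) S.kernel.measurable
      S.sample.measurable_X S.sample.measurable_Y
    -- Discarding the event of zero denominator leaves an open set of pairs, which suffices for a
    -- lower bound.
    refine le_trans (EReal.neg_le_neg_iff.2 ?_) ((S.hasLimitingCGF.le_liminf hmeas
      S.differentiable_pairPsi (isOpen_ratio_mem hU)).trans (liminf_le_liminf ?_))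
    · rw [S.semiRecJ_eq hg hKpos]
      refine le_iInf₂ fun s hs => le_iInf₂ fun t ht => iInf₂_le_of_le _ ?_ le_rfl
      exact ⟨ht, by simpa [inv_smul_smul₀ ht] using hs⟩
    · filter_upwards [hspeed.eventually_gt_atTop 0] with n hn
      refine mul_le_mul_of_nonneg_left (ENNReal.log_monotone (measure_mono fun ω hω => ?_))
        (EReal.coe_nonneg.2 (inv_nonneg.2 hn.le))
      obtain ⟨h1, h2⟩ := hω
      have h1' : semiRecDen K h X x n ω ≠ 0 := h1
      change semiRecEstimator K h X Y x n ω ∈ U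
      rw [semiRecEstimator, if_pos h1']
      exact h2
  upper V hV := by
    have hspeed := S.hasLimitingCGF.speed_tendsto
    -- This complement is the preimage of `V` together with the whole hyperplane of zero
    -- denominator. It is closed and contains the pair whenever the estimator is in `V`, whatever
    -- the default value; the hyperplane has infinite rate.
    have hF : IsClosed {z : PairSpace q | z.snd ≠ 0 ∧ z.snd⁻¹ • z.fst ∈ Vᶜ}ᶜ :=
      (isOpen_ratio_mem hV.isOpen_compl).isClosed_compl
    refine le_trans (limsup_le_limsup ?_) ((S.hasLimitingCGF.limsup_le hF).trans
      (EReal.neg_le_neg_iff.2 ?_))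
    · filter_upwards [hspeed.eventually_gt_atTop 0] with n hn
      refine mul_le_mul_of_nonneg_left (ENNReal.log_monotone (measure_mono fun ω hω => ?_))
        (EReal.coe_nonneg.2 (inv_nonneg.2 hn.le))
      rintro ⟨h1, h2⟩
      have h1' : semiRecDen K h X x n ω ≠ 0 := h1
      have hω' : semiRecEstimator K h X Y x n ω ∈ V := hω
      rw [semiRecEstimator, if_pos h1'] at hω'
      exact h2 hω'
    · refine le_iInf₂ fun z hz => ?_
      by_cases hz0 : z.snd = 0
      · rw [S.legendre_eq_top hg hKpos hz0.le]
        exact le_top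
      · have hzV : z.snd⁻¹ • z.fst ∈ V := by
          by_contra hcon
          exact hz ⟨hz0, hcon⟩
        refine (iInf₂_le _ hzV).trans ?_
        rw [S.semiRecJ_eq hg hKpos]
        refine (iInf₂_le z.snd hz0).trans ?_
        rw [toLp_smul_ratio hz0]

end LDP

end

theorem corollary2 {Ω : Type*} [MeasurableSpace Ω] (P : Measure Ω) [IsProbabilityMeasure P]
    {d q : ℕ} (X : ℕ → Ω → Euc d) (Y : ℕ → Ω → Euc q) (f : Euc d → Euc q → ℝ)
    (hsample : IsIIDSampleWithDensity P X Y f)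
    (K : Euc d → ℝ) (x : Euc d) (a c : ℝ) (h : ℕ → ℝ)
    (hc : 0 < c) (ha : 0 < a) (had : a < 1 / (d : ℝ))
    (hh : ∀ n, 1 ≤ n → h n = c * (n : ℝ) ^ (-a))
    (hg : 0 < marginalDensity f x)
    (hA1 : KernelAssumption K)
    (hA2 : ExpMomentAssumption f x)
    (hA1' : UniformExpMomentAssumption f x)
    (hC' : SemiRecCondition a K f x)
    (hK : ∀ z, 0 ≤ K z)
    (hKpos : volume {z : Euc d | 0 < K z} = ⊤) :
    IsGoodRateFunction (semiRecJ a K f x) ∧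
      SatisfiesLDP P (semiRecEstimator K h X Y x) (fun n => (n : ℝ) * h n ^ d)
        (semiRecJ a K f x) := by
  obtain ⟨C, hC⟩ := hA1.bounded
  have S : KernelSetting P X Y f K x h a c C :=
    ⟨hsample, hA1, hK, fun z => (le_abs_self _).trans (hC z), hA2, hA1', hc, ha, had, hh⟩
  refine ⟨?_, S.satisfiesLDP hg hKpos⟩
  rw [S.semiRecJ_eq hg hKpos]
  exact isGoodRateFunction_ratio (legendre_nonneg S.hasLimitingCGF.apply_zero)
    (lowerSemicontinuous_legendre _) (isCompact_legendre_le _)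
    fun z hz => S.legendre_eq_top hg hKpos hz
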